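/- Let $p$ be an odd prime, $n\ge 0$ an integer, and $\gamma$ a topological generator of $1+p\mathbf Z_p$. Put $$\rho_n=p^{-1/(p^{n-1}(p-1))},\qquad r_n=p^{\,n-1/(p-1)},\qquad \log_p(1+x)=\sum_{k\ge1}(-1)^{k+1}\frac{x^k}{k}.$$ Let $\mathscr W^0_n$ be the affinoid group over $\mathbf Q_p$ whose points over a complete extension $L/\mathbf Q_p$ are the continuous characters $\psi:\mathbf Z_p^\times\to L^\times$ that are trivial on $\mu_{p-1}$ and satisfy $|\psi(\gamma)-1|\le\rho_n$; in the coordinate $t=\psi(\gamma)-1$ its affinoid algebra is $$A=\Big\{\sum_{k\ge 0} a_kt^k : a_k\in\mathbf Q_p,\ |a_k|\rho_n^k\to0\Big\},$$ and its torsion subgroup $\mathscr W^0_n[p^n]$ has affinoid algebra $A/I$ with $I=((1+t)^{p^n}-1)$. Let $\mathbf A^1_{r_n}$ be the closed ball of radius $r_n$ centered at $0$ in the affine line, with affinoid algebra $$B=\Big\{\sum_{k\ge 0} b_ks^k : b_k\in\mathbf Q_p,\ |b_k|r_n^k\to0\Big\}.$$ Theorem. The function $\vartheta(\psi)=\log_p(\psi(\gamma))/\log_p(\gamma)$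 defines a morphism $\vartheta:\mathscr W^0_n\to\mathbf A^1_{r_n}$ which identifies $\mathbf A^1_{r_n}$ with the quotient of $\mathscr W^0_n$ by $\mathscr W^0_n[p^n]$. In detail: (i) There is a unique continuous $\mathbf Q_p$-algebra homomorphism $\varphi:B\to A$ with $\varphi(s)=\log_p(1+t)/\log_p(\gamma)$. For every complete extension $L/\mathbf Q_p$ there is a bijection $\psi\mapsto e_\psi$ from $\mathscr W^0_n(L)$ to the continuous $\mathbf Q_p$-algebra homomorphisms $A\to L$ such that $e_\psi(t)=\psi(\gamma)-1$; one has $e_\psi(\varphi(s))=\vartheta(\psi)$, $|\vartheta(\psi)|\le r_n$, and $e_\psi$ kills $I$ if and only if $\psi^{p^n}=1$. (ii) $\vartheta$ is surjective: every maximal ideal of $B$ is of the form $\varphi^{-1}(\mathfrak m)$ for some maximal ideal $\mathfrak m$ of $A$, and if $L$ is an algebraically closed complete extension of $\mathbf Q_p$ (such as $\mathbf C_p$), then every $x\in L$ with $|x|\le r_n$ equals $\vartheta(\psi)$ for some $\psi\in\mathscr W^0_n(L)$. (iii) There is a unique continuous $\mathbf Q_p$-algebra homomorphism $m:A\to (A/I)\,\widehat\otimes_{\mathbf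 Q_p}A$ with $m(t)=1\otimes t+t\otimes1+t\otimes t$ (the pullback along the multiplication $\mathscr W^0_n[p^n]\times\mathscr W^0_n\to\mathscr W^0_n$), and $m(\varphi(b))=1\otimes\varphi(b)$ for all $b\in B$; that is, the two compositions $\mathscr W^0_n[p^n]\times\mathscr W^0_n\rightrightarrows\mathscr W^0_n\to\mathbf A^1_{r_n}$ of $\vartheta$ with multiplication and with the second projection coincide. (iv) The resulting map $\mathscr W^0_n[p^n]\times\mathscr W^0_n\to\mathscr W^0_n\times_{\mathbf A^1_{r_n}}\mathscr W^0_n$ is an isomorphism: there is an isomorphism of topological rings $A\,\widehat\otimes_BA\to(A/I)\,\widehat\otimes_{\mathbf Q_p}A$ (where $A$ is a $B$-algebra via $\varphi$) sending $a\otimes1$ to $m(a)$ and $1\otimes a$ to $1\otimes a$ for all $a\in A$. -/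

import Mathlib

open scoped TensorProduct NNReal

noncomputable section

/-! ### Affinoid algebras of closed discs -/

/-- The `K`-algebra of power series `∑ aₖ Xᵏ` over `K` with `‖aₖ‖ cᵏ → 0`, as a subalgebra of the
algebra of all power series. -/
def tateDiskSubalgebra (K : Type*) [NormedField K] [IsUltrametricDist K] (c : ℝ≥0) :
    Subalgebra K (PowerSeries K) where
  __ := PowerSeries.IsRestricted.subring (R := K) (c : ℝ)
  algebraMap_mem' a := PowerSeries.isRestricted_C (c : ℝ) a

/-- The affinoid algebra over `K` of the closed disc `|X| ≤ c` centered at `0`: power series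
`∑ aₖ Xᵏ` over `K` with `‖aₖ‖ cᵏ → 0`. -/
def TateDisk (K : Type*) [NormedField K] [IsUltrametricDist K] (c : ℝ≥0) : Type _ :=
  tateDiskSubalgebra K c

namespace TateDisk

variable (K : Type*) [NormedField K] [IsUltrametricDist K] (c : ℝ≥0)

instance instCommRing : CommRing (TateDisk K c) :=
  inferInstanceAs (CommRing (tateDiskSubalgebra K c))

variable {K c}

/-- The underlying formal power series. -/
def toPowerSeries (f : TateDisk K c) : PowerSeries K := f.1

theorem tendsto_coeff (f : TateDisk K c) :
    Filter.Tendsto (fun k : ℕ ↦ ‖PowerSeries.coeff k f.toPowerSeries‖ * (c : ℝ) ^ k)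
      Filter.atTop (nhds 0) :=
  (PowerSeries.isRestricted_iff' (c : ℝ) f.toPowerSeries).1 f.2

theorem hasGaussNorm (f : TateDisk K c) :
    PowerSeries.HasGaussNorm (norm : K → ℝ) (c : ℝ) f.toPowerSeries :=
  f.tendsto_coeff.bddAbove_range

theorem norm_add_le_max (f g : TateDisk K c) :
    PowerSeries.gaussNorm (norm : K → ℝ) (c : ℝ) (f + g).toPowerSeries ≤
      max (PowerSeries.gaussNorm (norm : K → ℝ) (c : ℝ) f.toPowerSeries)
        (PowerSeries.gaussNorm (norm : K → ℝ) (c : ℝ) g.toPowerSeries) :=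
  PowerSeries.gaussNorm_add_le_max (norm : K → ℝ) (c : ℝ) f.toPowerSeries g.toPowerSeries c.2
    (fun a ↦ norm_nonneg a) (fun x y ↦ IsUltrametricDist.norm_add_le_max x y)
    f.hasGaussNorm g.hasGaussNorm

variable (K c)

/-- The Gauss norm `‖∑ aₖ Xᵏ‖ = supₖ ‖aₖ‖ cᵏ`. -/
def gaussSeminorm : RingSeminorm (TateDisk K c) where
  toFun f := PowerSeries.gaussNorm (norm : K → ℝ) (c : ℝ) f.toPowerSeries
  map_zero' := PowerSeries.gaussNorm_zero (norm : K → ℝ) (c : ℝ) norm_zero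
  add_le' f g := (norm_add_le_max f g).trans
    (max_le_add_of_nonneg
      (PowerSeries.gaussNorm_nonneg _ _ _ fun a ↦ norm_nonneg a)
      (PowerSeries.gaussNorm_nonneg _ _ _ fun a ↦ norm_nonneg a))
  neg' f := MvPowerSeries.gaussNorm_neg (norm : K → ℝ) _ norm_neg f.toPowerSeries
  mul_le' f g := MvPowerSeries.gaussNorm_mul_le (norm : K → ℝ) (fun _ : Unit ↦ (c : ℝ))
    f.toPowerSeries g.toPowerSeries (fun _ ↦ c.2) (fun a ↦ norm_nonneg a)
    (fun a b ↦ norm_mul_le a b) (fun x y ↦ IsUltrametricDist.norm_add_le_max x y) norm_zero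
    f.hasGaussNorm.hasMvGaussNorm g.hasGaussNorm.hasMvGaussNorm

instance instSeminormedCommRing : SeminormedCommRing (TateDisk K c) where
  __ := (gaussSeminorm K c).toSeminormedRing
  mul_comm := mul_comm

instance instAlgebra : Algebra K (TateDisk K c) :=
  inferInstanceAs (Algebra K (tateDiskSubalgebra K c))

/-- The coordinate function of the disc. -/
def coord : TateDisk K c :=
  ⟨PowerSeries.X, PowerSeries.isRestricted_monomial (c : ℝ) 1 1⟩

theorem norm_def (f : TateDisk K c) :
    ‖f‖ = ⨆ k : ℕ, ‖PowerSeries.coeff k f.toPowerSeries‖ * (c : ℝ) ^ k :=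
  PowerSeries.gaussNorm_eq (norm : K → ℝ) (c : ℝ) f.toPowerSeries

end TateDisk

/-! ### Completed tensor products -/

section CompletedTensor

variable (R M N : Type*) [CommRing R] [SeminormedCommRing M] [SeminormedCommRing N]
  [Algebra R M] [Algebra R N]

/-- The algebraic tensor product `M ⊗[R] N`, carrying the tensor product seminorm below. -/
def SeminormedTensor : Type _ := M ⊗[R] N

namespace SeminormedTensor

instance instCommRing : CommRing (SeminormedTensor R M N) :=
  inferInstanceAs (CommRing (M ⊗[R] N))

instance instAlgebra : Algebra R (SeminormedTensor R M N) :=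
  inferInstanceAs (Algebra R (M ⊗[R] N))

variable {M N} in
/-- The pure tensor `x ⊗ y`. -/
def pure (x : M) (y : N) : SeminormedTensor R M N := x ⊗ₜ[R] y

/-- The sums of finitely many pure tensors `x ⊗ y` with `‖x‖ ‖y‖ ≤ r`. -/
def sumsLE (r : ℝ) : AddSubmonoid (SeminormedTensor R M N) :=
  AddSubmonoid.closure {z | ∃ (x : M) (y : N), ‖x‖ * ‖y‖ ≤ r ∧ z = pure R x y}

/-- The (nonarchimedean) tensor product seminorm: the infimum, over all expressions
`z = ∑ xᵢ ⊗ yᵢ`, of `maxᵢ ‖xᵢ‖ ‖yᵢ‖`. -/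
def tensorNorm (z : SeminormedTensor R M N) : ℝ := sInf {r : ℝ | 0 ≤ r ∧ z ∈ sumsLE R M N r}

variable {R M N}

theorem sumsLE_mono {r s : ℝ} (h : r ≤ s) : sumsLE R M N r ≤ sumsLE R M N s :=
  AddSubmonoid.closure_mono fun _ ⟨x, y, hxy, hz⟩ ↦ ⟨x, y, hxy.trans h, hz⟩

theorem exists_mem_sumsLE (z : SeminormedTensor R M N) : ∃ r : ℝ, 0 ≤ r ∧ z ∈ sumsLE R M N r := by
  refine TensorProduct.induction_on (motive := fun z : M ⊗[R] N ↦
    ∃ r : ℝ, 0 ≤ r ∧ (show SeminormedTensor R M N from z) ∈ sumsLE R M N r) z ?_ ?_ ?_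
  · exact ⟨0, le_rfl, zero_mem _⟩
  · intro x y
    exact ⟨‖x‖ * ‖y‖, by positivity, AddSubmonoid.subset_closure ⟨x, y, le_rfl, rfl⟩⟩
  · rintro a b ⟨r, hr, ha⟩ ⟨s, hs, hb⟩
    exact ⟨max r s, le_max_of_le_left hr,
      add_mem (sumsLE_mono (le_max_left r s) ha) (sumsLE_mono (le_max_right r s) hb)⟩

theorem bddBelow (z : SeminormedTensor R M N) :
    BddBelow {r : ℝ | 0 ≤ r ∧ z ∈ sumsLE R M N r} := ⟨0, fun _ h ↦ h.1⟩

theorem tensorNorm_le {z : SeminormedTensor R M N} {r : ℝ} (hr : 0 ≤ r)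
    (hz : z ∈ sumsLE R M N r) : tensorNorm R M N z ≤ r :=
  csInf_le (bddBelow z) ⟨hr, hz⟩

theorem tensorNorm_nonneg (z : SeminormedTensor R M N) : 0 ≤ tensorNorm R M N z :=
  le_csInf (exists_mem_sumsLE z) fun _ h ↦ h.1

theorem mem_sumsLE_of_lt {z : SeminormedTensor R M N} {r : ℝ} (h : tensorNorm R M N z < r) :
    z ∈ sumsLE R M N r := by
  obtain ⟨s, hs, hsr⟩ := exists_lt_of_csInf_lt (exists_mem_sumsLE z) h
  exact sumsLE_mono hsr.le hs.2

theorem tensorNorm_add_le_max (z w : SeminormedTensor R M N) :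
    tensorNorm R M N (z + w) ≤ max (tensorNorm R M N z) (tensorNorm R M N w) := by
  refine le_of_forall_gt_imp_ge_of_dense fun r hr ↦ ?_
  have hz := (le_max_left _ _).trans_lt hr
  have hw := (le_max_right _ _).trans_lt hr
  exact tensorNorm_le ((tensorNorm_nonneg z).trans hz.le)
    (add_mem (mem_sumsLE_of_lt hz) (mem_sumsLE_of_lt hw))

theorem neg_mem_sumsLE {z : SeminormedTensor R M N} {r : ℝ} (h : z ∈ sumsLE R M N r) :
    -z ∈ sumsLE R M N r := by
  induction h using AddSubmonoid.closure_induction with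
  | mem z hz =>
    obtain ⟨x, y, hxy, rfl⟩ := hz
    exact AddSubmonoid.subset_closure ⟨-x, y, by rwa [norm_neg], (TensorProduct.neg_tmul x y).symm⟩
  | zero => rw [neg_zero]; exact zero_mem _
  | add a b _ _ ha hb => rw [neg_add]; exact add_mem ha hb

theorem mul_mem_sumsLE {z w : SeminormedTensor R M N} {r s : ℝ} (hr : 0 ≤ r)
    (hz : z ∈ sumsLE R M N r) (hw : w ∈ sumsLE R M N s) : z * w ∈ sumsLE R M N (r * s) := by
  induction hz using AddSubmonoid.closure_induction with
  | mem z hz =>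
    obtain ⟨x, y, hxy, rfl⟩ := hz
    induction hw using AddSubmonoid.closure_induction with
    | mem w hw =>
      obtain ⟨x', y', hxy', rfl⟩ := hw
      refine AddSubmonoid.subset_closure ⟨x * x', y * y', ?_,
        Algebra.TensorProduct.tmul_mul_tmul x x' y y'⟩
      calc ‖x * x'‖ * ‖y * y'‖ ≤ (‖x‖ * ‖x'‖) * (‖y‖ * ‖y'‖) := by
            gcongr
            · exact norm_mul_le x x'
            · exact norm_mul_le y y'
        _ = (‖x‖ * ‖y‖) * (‖x'‖ * ‖y'‖) := by ring
        _ ≤ r * s := mul_le_mul hxy hxy' (by positivity) hr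
    | zero => rw [mul_zero]; exact zero_mem _
    | add a b _ _ ha hb => rw [mul_add]; exact add_mem ha hb
  | zero => rw [zero_mul]; exact zero_mem _
  | add a b _ _ ha hb => rw [add_mul]; exact add_mem ha hb

variable (R M N)

/-- The tensor product seminorm as a ring seminorm. -/
def tensorSeminorm : RingSeminorm (SeminormedTensor R M N) where
  toFun := tensorNorm R M N
  map_zero' := le_antisymm (tensorNorm_le le_rfl (zero_mem _)) (tensorNorm_nonneg 0)
  add_le' z w := (tensorNorm_add_le_max z w).trans
    (max_le_add_of_nonneg (tensorNorm_nonneg z) (tensorNorm_nonneg w))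
  neg' z := by
    have key (z : SeminormedTensor R M N) : tensorNorm R M N (-z) ≤ tensorNorm R M N z :=
      le_csInf (exists_mem_sumsLE z) fun _ h ↦ tensorNorm_le h.1 (neg_mem_sumsLE h.2)
    exact le_antisymm (key z) (by simpa using key (-z))
  mul_le' z w := by
    refine le_mul_of_forall_lt₀ fun r hr s hs ↦ ?_
    have hr0 := (tensorNorm_nonneg z).trans hr.le
    exact tensorNorm_le (mul_nonneg hr0 ((tensorNorm_nonneg w).trans hs.le))
      (mul_mem_sumsLE hr0 (mem_sumsLE_of_lt hr) (mem_sumsLE_of_lt hs))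

instance instSeminormedCommRing : SeminormedCommRing (SeminormedTensor R M N) where
  __ := (tensorSeminorm R M N).toSeminormedRing
  mul_comm := mul_comm

end SeminormedTensor

/-- The completed tensor product `M ⊗̂[R] N`: the separated completion of `M ⊗[R] N` for the
tensor product seminorm. -/
def CompletedTensor : Type _ := UniformSpace.Completion (SeminormedTensor R M N)

namespace CompletedTensor

instance instNormedCommRing : NormedCommRing (CompletedTensor R M N) :=
  inferInstanceAs (NormedCommRing (UniformSpace.Completion (SeminormedTensor R M N)))

/-- The canonical ring homomorphism `M ⊗[R] N → M ⊗̂[R] N`. -/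
def ofTensor : M ⊗[R] N →+* CompletedTensor R M N :=
  (UniformSpace.Completion.coeRingHom :
    SeminormedTensor R M N →+* UniformSpace.Completion (SeminormedTensor R M N))

instance instAlgebra : Algebra R (CompletedTensor R M N) :=
  ((ofTensor R M N).comp (algebraMap R (M ⊗[R] N))).toAlgebra

/-- The map `x ↦ x ⊗ 1`. -/
def inclLeft : M →+* CompletedTensor R M N :=
  (ofTensor R M N).comp (Algebra.TensorProduct.includeLeftRingHom : M →+* M ⊗[R] N)

/-- The map `y ↦ 1 ⊗ y`. -/
def inclRight : N →+* CompletedTensor R M N :=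
  (ofTensor R M N).comp
    ((Algebra.TensorProduct.includeRight : N →ₐ[R] M ⊗[R] N) : N →+* M ⊗[R] N)

end CompletedTensor

end CompletedTensor

/-! ### Quotients of affinoid groups -/

/-- Let `G = Sp A` be an affinoid group over `K`, `H = Sp C` an affinoid subgroup, `X = Sp B`, let
`φ : B → A` be the pullback along a morphism `G → X`, and let `act : A → C ⊗̂ A` be the pullback
along the multiplication map `H × G → G`; the pullback along the projection `H × G → G` is
`a ↦ 1 ⊗ a`. This says that `X` is the quotient of `G` by `H`: the morphism `G → X` is surjective,
its two compositions with `H × G ⇉ G` coincide, and the resulting morphism `H × G → G ×_X G`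
(first component the multiplication, second component the projection) is an isomorphism,
where `G ×_X G = Sp (A ⊗̂[B] A)`. -/
structure IsAffinoidQuotient {K A B C : Type*} [NormedField K]
    [SeminormedCommRing A] [SeminormedCommRing B] [SeminormedCommRing C]
    [Algebra K A] [Algebra K B] [Algebra K C]
    (φ : B →A[K] A) (act : A →A[K] CompletedTensor K C A) : Prop where
  /-- surjectivity on the points (the maximal ideals) of the affinoid spaces -/
  surjective : ∀ m : Ideal B, m.IsMaximal →
    ∃ m' : Ideal A, m'.IsMaximal ∧ m'.comap (φ : B →ₐ[K] A) = m
  coincide : ∀ b : B, act (φ b) = CompletedTensor.inclRight K C A (φ b)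
  isomorphism :
    letI : Algebra B A := ((φ : B →ₐ[K] A) : B →+* A).toAlgebra
    ∃ Φ : CompletedTensor B A A ≃+* CompletedTensor K C A,
      Continuous Φ ∧ Continuous Φ.symm ∧
      (∀ a : A, Φ (CompletedTensor.inclLeft B A A a) = act a) ∧
      (∀ a : A, Φ (CompletedTensor.inclRight B A A a) = CompletedTensor.inclRight K C A a)

/-! ### Weight space -/

namespace WeightSpace

variable (p : ℕ) [Fact p.Prime]

/-- `γ` is a topological generator of the subgroup `1 + p ℤ_p` of `ℤ_p^×`. -/
def IsTopologicalGenerator (γ : ℤ_[p]ˣ) : Prop :=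
  closure (Subgroup.zpowers γ : Set ℤ_[p]ˣ) = {u : ℤ_[p]ˣ | (p : ℤ_[p]) ∣ (u : ℤ_[p]) - 1}

/-- The radius `p ^ (-1 / (p ^ (n - 1) (p - 1)))`. -/
def weightRadius (n : ℕ) : ℝ≥0 :=
  (p : ℝ≥0) ^ (-(1 / ((p : ℝ) ^ ((n : ℤ) - 1) * ((p : ℝ) - 1))))

/-- The radius `p ^ (n - 1 / (p - 1))`. -/
def ballRadius (n : ℕ) : ℝ≥0 :=
  (p : ℝ≥0) ^ ((n : ℝ) - 1 / ((p : ℝ) - 1))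

variable {p}

/-- The value `log_p (1 + x) = ∑_{k ≥ 1} (-1)^(k+1) x^k / k` of the `p`-adic logarithm. -/
def logOneAdd {L : Type*} [NormedField L] (x : L) : L :=
  ∑' k : ℕ, (-1) ^ k * x ^ (k + 1) / ((k : L) + 1)

/-- `log_p γ`, an element of `ℚ_p`. -/
def logGen (γ : ℤ_[p]ˣ) : ℚ_[p] := logOneAdd (((γ : ℤ_[p]) : ℚ_[p]) - 1)

/-- The `L`-valued points of `𝒲⁰_n`: the continuous characters `ψ : ℤ_p^× → L^×` lying in the
component `𝒲⁰` (that is, trivial on the `(p-1)`-st roots of unity) with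
`‖ψ γ - 1‖ ≤ p ^ (-1 / (p ^ (n - 1) (p - 1)))`. -/
def points (γ : ℤ_[p]ˣ) (n : ℕ) (L : Type*) [NormedField L] : Set (ℤ_[p]ˣ →ₜ* Lˣ) :=
  {ψ | (∀ u : ℤ_[p]ˣ, u ^ (p - 1) = 1 → ψ u = 1) ∧ ‖((ψ γ : Lˣ) : L) - 1‖ ≤ weightRadius p n}

/-- The value `ϑ(ψ) = log_p (ψ γ) / log_p γ`. -/
def theta (γ : ℤ_[p]ˣ) {L : Type*} [NormedField L] [NormedAlgebra ℚ_[p] L]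
    (ψ : ℤ_[p]ˣ →ₜ* Lˣ) : L :=
  logOneAdd (((ψ γ : Lˣ) : L) - 1) / algebraMap ℚ_[p] L (logGen γ)

variable (p)

/-- The affinoid algebra `A` of `𝒲⁰_n`, in the coordinate `t = ψ(γ) - 1`. -/
abbrev weightAlg (n : ℕ) : Type := TateDisk ℚ_[p] (weightRadius p n)

/-- The affinoid algebra `B` of the closed ball of radius `p ^ (n - 1 / (p - 1))` around `0` in the
affine line, in the coordinate `s`. -/
abbrev ballAlg (n : ℕ) : Type := TateDisk ℚ_[p] (ballRadius p n)

/-- The coordinate function `t = ψ(γ) - 1` on `𝒲⁰_n`. -/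
abbrev t (n : ℕ) : weightAlg p n := TateDisk.coord ℚ_[p] (weightRadius p n)

/-- The coordinate function `s` on the ball. -/
abbrev s (n : ℕ) : ballAlg p n := TateDisk.coord ℚ_[p] (ballRadius p n)

/-- The ideal `((1 + t) ^ (p ^ n) - 1)` of `A`, which cuts out the subgroup `𝒲⁰_n[p ^ n]`. -/
def torsionIdeal (n : ℕ) : Ideal (weightAlg p n) := Ideal.span {(1 + t p n) ^ (p ^ n) - 1}

/-- The affinoid algebra `A / ((1 + t) ^ (p ^ n) - 1)` of `𝒲⁰_n[p ^ n]`, with the residue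
seminorm. -/
abbrev torsionAlg (n : ℕ) : Type := weightAlg p n ⧸ torsionIdeal p n

end WeightSpace

end

/-!
# The quotient of weight space by its `p ^ n`-torsion

Put `q = p ^ n`. The point is that on both sides of `ϑ` one can pass to the function
`(1 + t) ^ q`. On `𝒲⁰_n` it is a monic polynomial in `t`, and it generates the ideal of the
`q`-torsion after subtracting `1`. On the ball it is the analytic function
`E = exp (q s log γ)`, because `exp (q log (1 + t)) = (1 + t) ^ q`
(`WeightSpace.thetaPullback_expFun`). The radii are such that `log (1 + t) / log γ` has Gauss norm
at most `ballRadius p n` and `E - 1` has Gauss norm at most `weightRadius p 0 < p ^ (-1 / (p - 1))`,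
which is the `q`-th power of `weightRadius p n`. In particular the logarithm of `E` converges and
recovers `s`, so that a continuous homomorphism out of the algebra `B` of the ball is determined by
the image of `E` (`WeightSpace.ballAlg_ringHom_ext`). Identities of power series are proved formally
and transported by `TateDisk.toPowerSeries_evalHom`: evaluation of one function on a disc at another
one without constant term is formal substitution.

* Multiplication by a torsion point does not change `(1 + t) ^ q`, hence does not change `ϑ`.
* If two points `x, y` of `𝒲⁰_n` have the same image, then `x ^ q = y ^ q`, so `x y⁻¹` is torsion.
  In terms of algebras, `t ↦ (1 + t) ⊗ (1 + t)⁻¹ - 1` defines a homomorphism from `A` to `A ⊗̂[B] A`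
  which kills `(1 + t) ^ q - 1`, and this provides the inverse of the map from `A ⊗̂[B] A` to the
  algebra of `𝒲⁰_n[q] × 𝒲⁰_n` (`WeightSpace.exists_ringEquiv_actionAlg`).
* For a point `x` of the ball over an algebraically closed field, a `q`-th root of `E(x)` has
  distance at most `weightRadius p n` from `1`, and is the value at `γ` of a character with image `x`
  (`WeightSpace.exists_theta_eq`).
* No monomial of `(1 + t) ^ q - 1` exceeds `t ^ q` in Gauss norm, so division by
  `(1 + t) ^ q - φ(E)` shows that `A` is generated by `1, t, …, t ^ (q - 1)` over `B`. Thus `A` is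
  integral over `B`, and maximal ideals of `B` lift to `A`
  (`WeightSpace.exists_isMaximal_comap_eq`).

Characters of `ℤ_p^×` trivial on the roots of unity are determined by their value at `γ`, and every
value `1 + z` with `‖z‖ < 1` occurs: `a ↦ γ ^ a` is an isomorphism of topological groups from `ℤ_p`
to `1 + p ℤ_p`, and `a ↦ (1 + z) ^ a` is a continuous character of `ℤ_p`.
-/

noncomputable section

open Filter Topology

/-! ### Functions on closed discs -/

section Ultrametric

theorem IsUltrametricDist.summable_of_tendsto_zero {R : Type*} [SeminormedAddCommGroup R]
    [IsUltrametricDist R] [CompleteSpace R] {u : ℕ → R} (hu : Tendsto u atTop (𝓝 0)) :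
    Summable u := by
  refine NonarchimedeanAddGroup.summable_of_tendsto_cofinite_zero ?_
  rwa [Nat.cofinite_eq_atTop]

theorem IsUltrametricDist.norm_hasSum_le {R : Type*} [SeminormedAddCommGroup R]
    [IsUltrametricDist R] {u : ℕ → R} {a : R} (ha : HasSum u a) {C : ℝ} (hC : 0 ≤ C)
    (h : ∀ k, ‖u k‖ ≤ C) : ‖a‖ ≤ C := by
  refine le_of_tendsto ha.norm (Eventually.of_forall fun s ↦ ?_)
  exact IsUltrametricDist.norm_sum_le_of_forall_le_of_nonneg hC fun i _ ↦ h i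

theorem IsUltrametricDist.norm_sub_le_of_le {R : Type*} [SeminormedAddCommGroup R]
    [IsUltrametricDist R] {x y : R} {C : ℝ} (hx : ‖x‖ ≤ C) (hy : ‖y‖ ≤ C) : ‖x - y‖ ≤ C := by
  rw [sub_eq_add_neg]
  exact (IsUltrametricDist.norm_add_le_max x (-y)).trans (max_le hx (by rwa [norm_neg]))

/-- A contractive additive map is continuous. -/
theorem AddMonoidHom.continuous_of_norm_le {M N F : Type*} [SeminormedAddCommGroup M]
    [SeminormedAddCommGroup N] [FunLike F M N] [AddMonoidHomClass F M N] (f : F)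
    (h : ∀ x, ‖f x‖ ≤ ‖x‖) : Continuous f :=
  AddMonoidHomClass.continuous_of_bound f 1 fun x ↦ by simpa using h x

end Ultrametric

namespace TateDisk

variable {K : Type*} [NormedField K] [IsUltrametricDist K] {c : ℝ≥0}

/-- The `k`-th coefficient of a function on the disc. -/
def coeff (k : ℕ) : TateDisk K c →+ K :=
  AddMonoidHom.mk' (fun f ↦ PowerSeries.coeff k f.toPowerSeries) fun f g ↦
    map_add (PowerSeries.coeff k) f.toPowerSeries g.toPowerSeries

theorem coeff_def (k : ℕ) (f : TateDisk K c) : coeff k f = PowerSeries.coeff k f.toPowerSeries :=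
  rfl

@[ext]
theorem ext {f g : TateDisk K c} (h : f.toPowerSeries = g.toPowerSeries) : f = g := Subtype.ext h

variable (K c) in
/-- Passage to the underlying formal power series, as a ring homomorphism. -/
def toPowerSeriesHom : TateDisk K c →+* PowerSeries K := (tateDiskSubalgebra K c).subtype

theorem toPowerSeriesHom_apply (f : TateDisk K c) : toPowerSeriesHom K c f = f.toPowerSeries := rfl

/-- The function given by a power series whose coefficients decay suitably. -/
def mk (f : PowerSeries K)
    (hf : Tendsto (fun k : ℕ ↦ ‖PowerSeries.coeff k f‖ * (c : ℝ) ^ k) atTop (𝓝 0)) :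
    TateDisk K c :=
  ⟨f, (PowerSeries.isRestricted_iff' (c : ℝ) f).2 hf⟩

@[simp]
theorem toPowerSeries_mk (f : PowerSeries K)
    (hf : Tendsto (fun k : ℕ ↦ ‖PowerSeries.coeff k f‖ * (c : ℝ) ^ k) atTop (𝓝 0)) :
    (mk f hf).toPowerSeries = f := rfl

theorem coeff_algebraMap_mul_coord_pow (a : K) (n k : ℕ) :
    coeff k (algebraMap K (TateDisk K c) a * coord K c ^ n) = if k = n then a else 0 := by
  have : (algebraMap K (TateDisk K c) a * coord K c ^ n).toPowerSeries =
      PowerSeries.C a * PowerSeries.X ^ n := by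
    simp only [← toPowerSeriesHom_apply, map_mul, map_pow]
    rfl
  rw [coeff_def, this, PowerSeries.coeff_C_mul_X_pow]

theorem norm_coeff_mul_pow_le (f : TateDisk K c) (k : ℕ) : ‖coeff k f‖ * (c : ℝ) ^ k ≤ ‖f‖ :=
  PowerSeries.le_gaussNorm (norm : K → ℝ) (c : ℝ) f.toPowerSeries f.hasGaussNorm k

theorem norm_le {f : TateDisk K c} {C : ℝ} (h : ∀ k, ‖coeff k f‖ * (c : ℝ) ^ k ≤ C) :
    ‖f‖ ≤ C := by
  rw [norm_def]
  exact ciSup_le h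

instance instIsUltrametricDist : IsUltrametricDist (TateDisk K c) :=
  IsUltrametricDist.isUltrametricDist_of_isNonarchimedean_norm fun f g ↦ norm_add_le_max f g

theorem norm_algebraMap_mul_coord_pow_le (a : K) (n : ℕ) :
    ‖algebraMap K (TateDisk K c) a * coord K c ^ n‖ ≤ ‖a‖ * (c : ℝ) ^ n := by
  refine norm_le fun k ↦ ?_
  rw [coeff_algebraMap_mul_coord_pow]
  split_ifs with h
  · rw [h]
  · rw [norm_zero, zero_mul]; positivity

theorem norm_algebraMap_le (a : K) : ‖algebraMap K (TateDisk K c) a‖ ≤ ‖a‖ := by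
  simpa using norm_algebraMap_mul_coord_pow_le (c := c) a 0

theorem norm_coord_pow_le (n : ℕ) : ‖coord K c ^ n‖ ≤ (c : ℝ) ^ n := by
  simpa using norm_algebraMap_mul_coord_pow_le (c := c) (1 : K) n

theorem norm_coord_le : ‖coord K c‖ ≤ c := by
  simpa using norm_coord_pow_le (K := K) (c := c) 1

theorem norm_one_le : ‖(1 : TateDisk K c)‖ ≤ 1 := by
  simpa using norm_coord_pow_le (K := K) (c := c) 0

/-- For `c = 0` this fails: the Gauss norm then only sees the constant term. -/
theorem t2Space (hc : 0 < c) : T2Space (TateDisk K c) := by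
  suffices T0Space (TateDisk K c) from inferInstance
  refine (t0Space_iff_inseparable _).2 fun f g h ↦ ?_
  have h0 : ‖f - g‖ = 0 := by rw [← dist_eq_norm]; exact Metric.inseparable_iff.1 h
  have : f.toPowerSeries = g.toPowerSeries := by
    ext k
    have h1 := norm_coeff_mul_pow_le (f - g) k
    rw [h0] at h1
    have h2 : (0 : ℝ) < (c : ℝ) ^ k := pow_pos (by exact_mod_cast hc) k
    have h3 : ‖coeff k (f - g)‖ = 0 := by
      refine le_antisymm ?_ (norm_nonneg _)
      by_contra h4
      exact absurd h1 (not_le.2 (mul_pos (not_le.1 h4) h2))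
    rw [norm_eq_zero, map_sub, sub_eq_zero] at h3
    exact h3
  exact ext this

/-- A function on the disc is the sum of its Taylor series. -/
theorem hasSum (f : TateDisk K c) :
    HasSum (fun k ↦ algebraMap K (TateDisk K c) (coeff k f) * coord K c ^ k) f := by
  rw [HasSum, SummationFilter.unconditional_filter, Metric.tendsto_nhds]
  intro ε hε
  have h := f.tendsto_coeff.eventually_lt_const (half_pos hε)
  obtain ⟨N, hN⟩ := eventually_atTop.1 h
  filter_upwards [eventually_ge_atTop (Finset.range N)] with s hs
  rw [dist_eq_norm]
  refine lt_of_le_of_lt (norm_le fun k ↦ ?_) (half_lt_self hε)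
  rw [map_sub, map_sum]
  simp only [coeff_algebraMap_mul_coord_pow, Finset.sum_ite_eq]
  split_ifs with hk
  · simp [(half_pos hε).le]
  · rw [zero_sub, norm_neg]
    refine (hN k ?_).le
    by_contra hlt
    exact hk (hs (Finset.mem_range.2 (not_le.1 hlt)))

/-- A Cauchy sequence converges coefficientwise, uniformly for the weights `c ^ k`, so that the limit
of its coefficients is again restricted. -/
theorem completeSpace [CompleteSpace K] (hc : 0 < c) : CompleteSpace (TateDisk K c) := by
  have hc' : (0 : ℝ) < c := by exact_mod_cast hc
  refine Metric.complete_of_cauchySeq_tendsto fun u hu ↦ ?_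
  have hu' := Metric.cauchySeq_iff.1 hu
  have key (ε : ℝ) (hε : 0 < ε) : ∃ N, ∀ m ≥ N, ∀ n ≥ N, ∀ k,
      ‖coeff k (u m) - coeff k (u n)‖ * (c : ℝ) ^ k < ε := by
    obtain ⟨N, hN⟩ := hu' ε hε
    refine ⟨N, fun m hm n hn k ↦ ?_⟩
    rw [← map_sub]
    refine (norm_coeff_mul_pow_le _ k).trans_lt ?_
    rw [← dist_eq_norm]
    exact hN m hm n hn
  have hcoeff (k : ℕ) : ∃ a, Tendsto (fun n ↦ coeff k (u n)) atTop (𝓝 a) := by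
    refine cauchySeq_tendsto_of_complete (Metric.cauchySeq_iff.2 fun ε hε ↦ ?_)
    obtain ⟨N, hN⟩ := key (ε * (c : ℝ) ^ k) (by positivity)
    refine ⟨N, fun m hm n hn ↦ ?_⟩
    rw [dist_eq_norm]
    exact lt_of_mul_lt_mul_right (hN m hm n hn k) (by positivity)
  choose a ha using hcoeff
  have key2 (ε : ℝ) (hε : 0 < ε) : ∃ N, ∀ m ≥ N, ∀ k,
      ‖coeff k (u m) - a k‖ * (c : ℝ) ^ k ≤ ε := by
    obtain ⟨N, hN⟩ := key ε hε
    refine ⟨N, fun m hm k ↦ ?_⟩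
    refine le_of_tendsto (((tendsto_const_nhds.sub (ha k)).norm).mul_const _) ?_
    filter_upwards [eventually_ge_atTop N] with n hn
    exact (hN m hm n hn k).le
  have hlim : Tendsto (fun k : ℕ ↦ ‖PowerSeries.coeff k (PowerSeries.mk a)‖ * (c : ℝ) ^ k)
      atTop (𝓝 0) := by
    rw [Metric.tendsto_nhds]
    intro ε hε
    obtain ⟨N, hN⟩ := key2 (ε / 2) (half_pos hε)
    filter_upwards [(u N).tendsto_coeff.eventually_lt_const hε] with k hk
    rw [PowerSeries.coeff_mk, dist_zero_right, norm_mul, norm_norm, norm_pow,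
      Real.norm_of_nonneg hc'.le]
    have h1 : ‖a k‖ ≤ max ‖coeff k (u N)‖ ‖coeff k (u N) - a k‖ := by
      have := IsUltrametricDist.norm_add_le_max (coeff k (u N)) (-(coeff k (u N) - a k))
      rwa [norm_neg, ← sub_eq_add_neg, sub_sub_cancel] at this
    refine (mul_le_mul_of_nonneg_right h1 (by positivity)).trans_lt ?_
    rw [max_mul_of_nonneg _ _ (by positivity)]
    exact max_lt hk ((hN N le_rfl k).trans_lt (half_lt_self hε))
  refine ⟨mk (PowerSeries.mk a) hlim, Metric.tendsto_atTop.2 fun ε hε ↦ ?_⟩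
  obtain ⟨N, hN⟩ := key2 (ε / 2) (half_pos hε)
  refine ⟨N, fun n hn ↦ ?_⟩
  rw [dist_eq_norm]
  refine lt_of_le_of_lt (norm_le fun k ↦ ?_) (half_lt_self hε)
  rw [map_sub, coeff_def k (mk _ _), toPowerSeries_mk, PowerSeries.coeff_mk]
  exact hN n hn k

/-- A continuous homomorphism out of the algebra of a disc is determined by its restriction to
the constants and by the image of the coordinate. -/
theorem ringHom_ext {R : Type*} [Ring R] [TopologicalSpace R] [T2Space R]
    {f g : TateDisk K c →+* R} (hf : Continuous f) (hg : Continuous g)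
    (hK : ∀ a, f (algebraMap K _ a) = g (algebraMap K _ a)) (hX : f (coord K c) = g (coord K c)) :
    f = g := by
  refine RingHom.ext fun x ↦ ?_
  have h1 := x.hasSum.map f hf
  have h2 := x.hasSum.map g hg
  have h3 : f ∘ (fun k ↦ algebraMap K (TateDisk K c) (coeff k x) * coord K c ^ k) =
      g ∘ (fun k ↦ algebraMap K (TateDisk K c) (coeff k x) * coord K c ^ k) :=
    funext fun k ↦ by simp [hK, hX]
  rw [h3] at h1
  exact h1.unique h2

section Eval

theorem norm_map_mul_pow_le {K : Type*} [NormedField K] {c : ℝ≥0} {R : Type*}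
    [SeminormedCommRing R] {i : K →+* R} (hi : ∀ a, ‖i a‖ ≤ ‖a‖) {x : R} (hx : ‖x‖ ≤ c) (a : K) (k : ℕ) :
    ‖i a * x ^ k‖ ≤ ‖a‖ * (c : ℝ) ^ k := by
  rcases Nat.eq_zero_or_pos k with rfl | hk
  · simpa using hi a
  · exact (norm_mul_le _ _).trans (mul_le_mul (hi a)
      ((norm_pow_le' x hk).trans (by gcongr)) (norm_nonneg _) (norm_nonneg _))

variable {R : Type*} [SeminormedCommRing R] [IsUltrametricDist R] [CompleteSpace R]

theorem summable_eval {i : K →+* R} (hi : ∀ a, ‖i a‖ ≤ ‖a‖) {x : R} (hx : ‖x‖ ≤ c)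
    (f : TateDisk K c) : Summable fun k ↦ i (coeff k f) * x ^ k :=
  IsUltrametricDist.summable_of_tendsto_zero
    (squeeze_zero_norm (fun k ↦ norm_map_mul_pow_le hi hx _ k) f.tendsto_coeff)

theorem norm_tsum_eval_le {i : K →+* R} (hi : ∀ a, ‖i a‖ ≤ ‖a‖) {x : R} (hx : ‖x‖ ≤ c)
    (f : TateDisk K c) : ‖∑' k, i (coeff k f) * x ^ k‖ ≤ ‖f‖ :=
  IsUltrametricDist.norm_hasSum_le (summable_eval hi hx f).hasSum (norm_nonneg f)
    fun k ↦ (norm_map_mul_pow_le hi hx _ k).trans (norm_coeff_mul_pow_le f k)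

variable [T2Space R]

/-- Evaluation at a point `x` of norm at most `c`, as an additive map. -/
def evalAddHom (i : K →+* R) (hi : ∀ a, ‖i a‖ ≤ ‖a‖) (x : R) (hx : ‖x‖ ≤ c) :
    TateDisk K c →+ R :=
  AddMonoidHom.mk' (fun f ↦ ∑' k, i (coeff k f) * x ^ k) fun f g ↦ by
    rw [← (summable_eval hi hx f).tsum_add (summable_eval hi hx g)]
    simp only [map_add, add_mul]

theorem evalAddHom_apply {i : K →+* R} (hi : ∀ a, ‖i a‖ ≤ ‖a‖) {x : R} (hx : ‖x‖ ≤ c)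
    (f : TateDisk K c) : evalAddHom i hi x hx f = ∑' k, i (coeff k f) * x ^ k := rfl

theorem continuous_evalAddHom {i : K →+* R} (hi : ∀ a, ‖i a‖ ≤ ‖a‖) {x : R} (hx : ‖x‖ ≤ c) :
    Continuous (evalAddHom i hi x hx) :=
  AddMonoidHom.continuous_of_norm_le _ fun f ↦ norm_tsum_eval_le hi hx f

theorem evalAddHom_monomial {i : K →+* R} (hi : ∀ a, ‖i a‖ ≤ ‖a‖) {x : R} (hx : ‖x‖ ≤ c)
    (a : K) (n : ℕ) :
    evalAddHom i hi x hx (algebraMap K _ a * coord K c ^ n) = i a * x ^ n := by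
  rw [evalAddHom_apply, tsum_eq_single n]
  · rw [coeff_algebraMap_mul_coord_pow, if_pos rfl]
  · intro k hk
    rw [coeff_algebraMap_mul_coord_pow, if_neg hk, map_zero, zero_mul]

/-- Two continuous additive maps on the algebra of a disc which agree on monomials are equal. -/
theorem addMonoidHom_ext {S : Type*} [AddCommGroup S] [TopologicalSpace S] [T2Space S]
    {f g : TateDisk K c →+ S} (hf : Continuous f) (hg : Continuous g)
    (h : ∀ a n, f (algebraMap K _ a * coord K c ^ n) = g (algebraMap K _ a * coord K c ^ n)) :
    f = g := by
  refine AddMonoidHom.ext fun x ↦ ?_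
  have h1 := x.hasSum.map f hf
  have h2 := x.hasSum.map g hg
  have h3 : f ∘ (fun k ↦ algebraMap K (TateDisk K c) (coeff k x) * coord K c ^ k) =
      g ∘ (fun k ↦ algebraMap K (TateDisk K c) (coeff k x) * coord K c ^ k) :=
    funext fun k ↦ h _ _
  rw [h3] at h1
  exact h1.unique h2

theorem evalAddHom_mul {i : K →+* R} (hi : ∀ a, ‖i a‖ ≤ ‖a‖) {x : R} (hx : ‖x‖ ≤ c)
    (f g : TateDisk K c) :
    evalAddHom i hi x hx (f * g) = evalAddHom i hi x hx f * evalAddHom i hi x hx g := by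
  have hc := continuous_evalAddHom hi hx
  -- Both sides are continuous and additive in each variable, so monomials suffice.
  have h (a : K) (n : ℕ) (g : TateDisk K c) :
      evalAddHom i hi x hx (algebraMap K _ a * coord K c ^ n * g) =
        i a * x ^ n * evalAddHom i hi x hx g := by
    refine DFunLike.congr_fun (addMonoidHom_ext
      (f := (evalAddHom i hi x hx).comp (AddMonoidHom.mulLeft (algebraMap K _ a * coord K c ^ n)))
      (g := (AddMonoidHom.mulLeft (i a * x ^ n)).comp (evalAddHom i hi x hx))
      (hc.comp (continuous_const_mul _)) (continuous_const.mul hc) fun b m ↦ ?_) g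
    simp only [AddMonoidHom.comp_apply, AddMonoidHom.coe_mulLeft, evalAddHom_monomial]
    have : algebraMap K (TateDisk K c) a * coord K c ^ n * (algebraMap K _ b * coord K c ^ m) =
        algebraMap K _ (a * b) * coord K c ^ (n + m) := by rw [map_mul]; ring
    rw [this, evalAddHom_monomial, map_mul]
    ring
  refine DFunLike.congr_fun (addMonoidHom_ext
    (f := (evalAddHom i hi x hx).comp (AddMonoidHom.mulRight g))
    (g := (AddMonoidHom.mulRight (evalAddHom i hi x hx g)).comp (evalAddHom i hi x hx))
    (hc.comp (continuous_mul_const _)) (hc.mul continuous_const) fun a n ↦ ?_) f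
  simp only [AddMonoidHom.comp_apply, AddMonoidHom.coe_mulRight, evalAddHom_monomial, h]

/-- Evaluation of functions on the disc of radius `c` at an element `x` with `‖x‖ ≤ c` of a complete
ultrametric ring `R`, where `R` receives the constants through a contractive homomorphism `i`. -/
def evalHom (i : K →+* R) (hi : ∀ a, ‖i a‖ ≤ ‖a‖) (x : R) (hx : ‖x‖ ≤ c) : TateDisk K c →+* R where
  __ := evalAddHom i hi x hx
  map_one' := by
    change evalAddHom i hi x hx 1 = 1
    simpa using evalAddHom_monomial hi hx 1 0
  map_mul' := evalAddHom_mul hi hx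

theorem evalHom_apply {i : K →+* R} (hi : ∀ a, ‖i a‖ ≤ ‖a‖) {x : R} (hx : ‖x‖ ≤ c)
    (f : TateDisk K c) : evalHom i hi x hx f = ∑' k, i (coeff k f) * x ^ k := rfl

theorem hasSum_evalHom {i : K →+* R} (hi : ∀ a, ‖i a‖ ≤ ‖a‖) {x : R} (hx : ‖x‖ ≤ c)
    (f : TateDisk K c) : HasSum (fun k ↦ i (coeff k f) * x ^ k) (evalHom i hi x hx f) :=
  (summable_eval hi hx f).hasSum

theorem norm_evalHom_le {i : K →+* R} (hi : ∀ a, ‖i a‖ ≤ ‖a‖) {x : R} (hx : ‖x‖ ≤ c)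
    (f : TateDisk K c) : ‖evalHom i hi x hx f‖ ≤ ‖f‖ := norm_tsum_eval_le hi hx f

theorem continuous_evalHom {i : K →+* R} (hi : ∀ a, ‖i a‖ ≤ ‖a‖) {x : R} (hx : ‖x‖ ≤ c) :
    Continuous (evalHom i hi x hx) := continuous_evalAddHom hi hx

theorem evalHom_coord {i : K →+* R} (hi : ∀ a, ‖i a‖ ≤ ‖a‖) {x : R} (hx : ‖x‖ ≤ c) :
    evalHom i hi x hx (coord K c) = x := by
  have := evalAddHom_monomial hi hx 1 1
  rwa [map_one, map_one, one_mul, one_mul, pow_one, pow_one] at this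

theorem evalHom_algebraMap {i : K →+* R} (hi : ∀ a, ‖i a‖ ≤ ‖a‖) {x : R} (hx : ‖x‖ ≤ c) (a : K) :
    evalHom i hi x hx (algebraMap K _ a) = i a := by
  have := evalAddHom_monomial hi hx a 0
  rwa [pow_zero, pow_zero, mul_one, mul_one] at this

/-- Evaluation of functions on the disc at a point of a complete ultrametric `K`-algebra, as a
continuous `K`-algebra homomorphism. -/
def evalAlgHom [Algebra K R] (hi : ∀ a, ‖algebraMap K R a‖ ≤ ‖a‖) (x : R) (hx : ‖x‖ ≤ c) :
    TateDisk K c →A[K] R where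
  __ := evalHom (algebraMap K R) hi x hx
  commutes' a := evalHom_algebraMap hi hx a
  cont := continuous_evalHom hi hx

theorem evalAlgHom_apply [Algebra K R] (hi : ∀ a, ‖algebraMap K R a‖ ≤ ‖a‖) {x : R} (hx : ‖x‖ ≤ c)
    (f : TateDisk K c) : evalAlgHom hi x hx f = evalHom (algebraMap K R) hi x hx f := rfl

theorem evalAlgHom_coord [Algebra K R] (hi : ∀ a, ‖algebraMap K R a‖ ≤ ‖a‖) {x : R} (hx : ‖x‖ ≤ c) :
    evalAlgHom hi x hx (coord K c) = x := evalHom_coord hi hx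

theorem norm_evalAlgHom_le [Algebra K R] (hi : ∀ a, ‖algebraMap K R a‖ ≤ ‖a‖) {x : R}
    (hx : ‖x‖ ≤ c) (f : TateDisk K c) : ‖evalAlgHom hi x hx f‖ ≤ ‖f‖ := norm_evalHom_le hi hx f

end Eval

theorem algHom_ext {R : Type*} [Ring R] [TopologicalSpace R] [T2Space R] [Algebra K R]
    {f g : TateDisk K c →A[K] R} (h : f (coord K c) = g (coord K c)) : f = g := by
  have := ringHom_ext (f := ((f : TateDisk K c →ₐ[K] R) : TateDisk K c →+* R))
    (g := ((g : TateDisk K c →ₐ[K] R) : TateDisk K c →+* R)) f.cont g.cont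
    (fun a ↦ (AlgHomClass.commutes f a).trans (AlgHomClass.commutes g a).symm) h
  exact ContinuousAlgHom.ext fun x ↦ DFunLike.congr_fun this x

/-- On functions without constant term, evaluation is substitution of formal power series. -/
theorem toPowerSeries_evalHom {c' : ℝ≥0} (hc : 0 < c)
    [CompleteSpace (TateDisk K c)] [T2Space (TateDisk K c)] (g : TateDisk K c) (hg : ‖g‖ ≤ c')
    (h0 : PowerSeries.constantCoeff g.toPowerSeries = 0) (f : TateDisk K c') :
    (evalHom (algebraMap K (TateDisk K c)) norm_algebraMap_le g hg f).toPowerSeries =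
      f.toPowerSeries.subst g.toPowerSeries := by
  have hs : PowerSeries.HasSubst g.toPowerSeries := .of_constantCoeff_zero' h0
  ext d
  -- Taking the `d`-th coefficient is continuous; for `f(g)` only finitely many terms contribute.
  have hcont : Continuous (coeff d : TateDisk K c →+ K) := by
    have hcd : (0 : ℝ) < (c : ℝ) ^ d := pow_pos (by exact_mod_cast hc) d
    refine AddMonoidHomClass.continuous_of_bound _ ((c : ℝ) ^ d)⁻¹ fun x ↦ ?_
    rw [inv_mul_eq_div, le_div_iff₀ hcd]
    exact norm_coeff_mul_pow_le x d
  have h1 := (hasSum_evalHom (i := algebraMap K (TateDisk K c)) norm_algebraMap_le hg f).map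
    (coeff d) hcont
  rw [PowerSeries.coeff_subst' hs, ← coeff_def]
  have h2 (k : ℕ) : coeff d (algebraMap K (TateDisk K c) (coeff k f) * g ^ k) =
      PowerSeries.coeff k f.toPowerSeries • PowerSeries.coeff d (g.toPowerSeries ^ k) := by
    have : (algebraMap K (TateDisk K c) (coeff k f) * g ^ k).toPowerSeries =
        PowerSeries.C (coeff k f) * g.toPowerSeries ^ k := by
      simp only [← toPowerSeriesHom_apply, map_mul, map_pow]
      rfl
    rw [coeff_def, this, PowerSeries.coeff_C_mul, smul_eq_mul]
    rfl
  have h3 := PowerSeries.coeff_subst_finite' hs f.toPowerSeries d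
  have h4 := hasSum_sum_of_ne_finset_zero (f := fun k ↦ PowerSeries.coeff k f.toPowerSeries •
    PowerSeries.coeff d (g.toPowerSeries ^ k)) (s := h3.toFinset) (L := .unconditional ℕ)
    fun k hk ↦ by simpa [or_iff_not_imp_left] using hk
  rw [finsum_eq_sum _ h3]
  refine h1.unique ?_
  convert h4 using 2
  exact h2 _

end TateDisk

/-! ### Homomorphisms between completed tensor products -/

namespace CompletedTensor

variable {R M N : Type*} [CommRing R] [SeminormedCommRing M] [SeminormedCommRing N]
  [Algebra R M] [Algebra R N]

instance instCompleteSpace : CompleteSpace (CompletedTensor R M N) :=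
  inferInstanceAs (CompleteSpace (UniformSpace.Completion (SeminormedTensor R M N)))

theorem norm_ofTensor (z : M ⊗[R] N) :
    ‖ofTensor R M N z‖ = SeminormedTensor.tensorNorm R M N z :=
  UniformSpace.Completion.norm_coe (E := SeminormedTensor R M N) z

theorem denseRange_ofTensor : DenseRange (ofTensor R M N) :=
  UniformSpace.Completion.denseRange_coe (α := SeminormedTensor R M N)

instance instIsUltrametricDist : IsUltrametricDist (CompletedTensor R M N) := by
  refine IsUltrametricDist.isUltrametricDist_of_isNonarchimedean_norm fun x y ↦ ?_
  refine (denseRange_ofTensor (R := R) (M := M) (N := N)).induction_on₂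
    (p := fun x y ↦ ‖x + y‖ ≤ max ‖x‖ ‖y‖) ?_ (fun a b ↦ ?_) x y
  · exact isClosed_le (by fun_prop) (by fun_prop)
  · rw [← map_add]
    simp only [norm_ofTensor]
    exact SeminormedTensor.tensorNorm_add_le_max (R := R) (M := M) (N := N) a b

theorem norm_inclLeft_mul_inclRight_le (x : M) (y : N) :
    ‖inclLeft R M N x * inclRight R M N y‖ ≤ ‖x‖ * ‖y‖ := by
  have : inclLeft R M N x * inclRight R M N y = ofTensor R M N (x ⊗ₜ y) := by
    change ofTensor R M N (x ⊗ₜ 1) * ofTensor R M N (1 ⊗ₜ y) = _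
    rw [← map_mul, Algebra.TensorProduct.tmul_mul_tmul, mul_one, one_mul]
  rw [this, norm_ofTensor]
  exact SeminormedTensor.tensorNorm_le (by positivity)
    (AddSubmonoid.subset_closure ⟨x, y, le_rfl, rfl⟩)

theorem norm_inclLeft_le (hN : ‖(1 : N)‖ ≤ 1) (x : M) : ‖inclLeft R M N x‖ ≤ ‖x‖ := by
  have := norm_inclLeft_mul_inclRight_le (R := R) x (1 : N)
  rw [map_one, mul_one] at this
  exact this.trans (mul_le_of_le_one_right (norm_nonneg _) hN)

theorem norm_inclRight_le (hM : ‖(1 : M)‖ ≤ 1) (y : N) : ‖inclRight R M N y‖ ≤ ‖y‖ := by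
  have := norm_inclLeft_mul_inclRight_le (R := R) (1 : M) y
  rw [map_one, one_mul] at this
  exact this.trans (mul_le_of_le_one_left (norm_nonneg _) hM)

theorem inclLeft_algebraMap (r : R) :
    inclLeft R M N (algebraMap R M r) = inclRight R M N (algebraMap R N r) := by
  change ofTensor R M N (algebraMap R M r ⊗ₜ 1) = ofTensor R M N (1 ⊗ₜ algebraMap R N r)
  rw [Algebra.algebraMap_eq_smul_one, Algebra.algebraMap_eq_smul_one, TensorProduct.smul_tmul]

theorem algebraMap_eq_inclRight (r : R) :
    algebraMap R (CompletedTensor R M N) r = inclRight R M N (algebraMap R N r) :=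
  inclLeft_algebraMap r

/-- Two continuous homomorphisms out of a completed tensor product which agree on both factors are
equal. -/
theorem ringHom_ext {S : Type*} [Ring S] [TopologicalSpace S] [T2Space S]
    {f g : CompletedTensor R M N →+* S} (hf : Continuous f) (hg : Continuous g)
    (hl : ∀ x, f (inclLeft R M N x) = g (inclLeft R M N x))
    (hr : ∀ y, f (inclRight R M N y) = g (inclRight R M N y)) : f = g := by
  refine DFunLike.coe_injective (denseRange_ofTensor.equalizer hf hg (funext fun z ↦ ?_))
  change (f.comp (ofTensor R M N)) z = (g.comp (ofTensor R M N)) z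
  induction z using TensorProduct.induction_on with
  | zero => simp
  | add a b ha hb => rw [map_add, map_add, ha, hb]
  | tmul x y =>
    have : ofTensor R M N (x ⊗ₜ y) = inclLeft R M N x * inclRight R M N y := by
      change _ = ofTensor R M N (x ⊗ₜ 1) * ofTensor R M N (1 ⊗ₜ y)
      rw [← map_mul, Algebra.TensorProduct.tmul_mul_tmul, mul_one, one_mul]
    simp only [RingHom.comp_apply, this, map_mul, hl, hr]

/-- Contractive homomorphisms from both factors to a complete ultrametric ring which agree on the
base ring extend to the completed tensor product. -/
theorem exists_lift {S : Type*} [NormedCommRing S] [IsUltrametricDist S] [CompleteSpace S]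
    (f : M →+* S) (g : N →+* S) (hfg : ∀ r : R, f (algebraMap R M r) = g (algebraMap R N r))
    (hf : ∀ x, ‖f x‖ ≤ ‖x‖) (hg : ∀ y, ‖g y‖ ≤ ‖y‖) :
    ∃ F : CompletedTensor R M N →+* S, Continuous F ∧
      (∀ x, F (inclLeft R M N x) = f x) ∧ (∀ y, F (inclRight R M N y) = g y) := by
  let : Algebra R S := (f.comp (algebraMap R M)).toAlgebra
  let f' : M →ₐ[R] S := { f with commutes' := fun r ↦ rfl }
  let g' : N →ₐ[R] S := { g with commutes' := fun r ↦ (hfg r).symm }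
  let F₀ : M ⊗[R] N →ₐ[R] S := Algebra.TensorProduct.lift f' g' fun _ _ ↦ Commute.all _ _
  have hF₀ (x : M) (y : N) : F₀ (x ⊗ₜ y) = f x * g y := Algebra.TensorProduct.lift_tmul ..
  let F₁ : SeminormedTensor R M N →+* S := (F₀ : M ⊗[R] N →+* S)
  have hbd (r : ℝ) (hr : 0 ≤ r) (z) (hz : z ∈ SeminormedTensor.sumsLE R M N r) : ‖F₁ z‖ ≤ r := by
    induction hz using AddSubmonoid.closure_induction with
    | mem z hz =>
      obtain ⟨x, y, hxy, rfl⟩ := hz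
      change ‖F₀ (x ⊗ₜ y)‖ ≤ r
      rw [hF₀]
      exact (norm_mul_le _ _).trans
        ((mul_le_mul (hf x) (hg y) (norm_nonneg _) (norm_nonneg _)).trans hxy)
    | zero => rwa [map_zero, norm_zero]
    | add a b _ _ ha hb =>
      rw [map_add]
      exact (IsUltrametricDist.norm_add_le_max _ _).trans (max_le ha hb)
  have hF₁ (z : SeminormedTensor R M N) : ‖F₁ z‖ ≤ ‖z‖ :=
    le_csInf (SeminormedTensor.exists_mem_sumsLE z) fun r hr ↦ hbd r hr.1 z hr.2
  have hc : Continuous F₁ := AddMonoidHom.continuous_of_norm_le F₁ hF₁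
  refine ⟨UniformSpace.Completion.extensionHom F₁ hc, UniformSpace.Completion.continuous_extension,
    fun x ↦ ?_, fun y ↦ ?_⟩
  · refine (UniformSpace.Completion.extensionHom_coe F₁ hc _).trans ?_
    refine (hF₀ x 1).trans ?_
    rw [map_one, mul_one]
  · refine (UniformSpace.Completion.extensionHom_coe F₁ hc _).trans ?_
    refine (hF₀ 1 y).trans ?_
    rw [map_one, one_mul]

end CompletedTensor

/-- A contractive homomorphism which kills an ideal is contractive on the quotient. -/
theorem Ideal.Quotient.norm_lift_le {A S : Type*} [SeminormedCommRing A] [SeminormedCommRing S]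
    (I : Ideal A) (f : A →+* S) (hI : ∀ a ∈ I, f a = 0) (hf : ∀ a, ‖f a‖ ≤ ‖a‖) (x : A ⧸ I) :
    ‖Ideal.Quotient.lift I f hI x‖ ≤ ‖x‖ := by
  refine le_of_forall_pos_lt_add fun ε hε ↦ ?_
  obtain ⟨a, rfl, ha⟩ := Ideal.Quotient.norm_mk_lt x hε
  rw [Ideal.Quotient.lift_mk]
  exact (hf a).trans_lt ha

/-! ### Formal exponential and logarithm -/

namespace PowerSeries

variable {K : Type*} [Field K] [Algebra ℚ K]

theorem one_add_X_mul_deriv_log : (1 + X) * d⁄dX K (log K) = 1 := by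
  rw [deriv_log]
  ext n
  rw [add_mul, one_mul, map_add, coeff_one]
  cases n with
  | zero => simp
  | succ n => simp [coeff_succ_X_mul, pow_succ]

theorem constantCoeff_subst_of_constantCoeff_eq_zero {R : Type*} [CommRing R] {g : PowerSeries R}
    (h0 : constantCoeff g = 0) (f : PowerSeries R) :
    constantCoeff (f.subst g) = constantCoeff f := by
  have hs : HasSubst g := .of_constantCoeff_zero' h0
  rw [← coeff_zero_eq_constantCoeff_apply, coeff_subst' hs, finsum_eq_single _ 0]
  · simp
  · intro n hn
    simp [h0, hn]

/-- The identity `exp (log (1 + X)) = 1 + X`. -/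
theorem exp_subst_log : (exp K).subst (log K) = 1 + X := by
  have : CharZero K := algebraRat.charZero K
  have hlog : HasSubst (log K) := HasSubst.log
  have hu := one_add_X_mul_deriv_log (K := K)
  set u := d⁄dX K (log K) with hu_def
  -- The derivative `u` of `log (1 + X)` inverts `1 + X`, and `exp (log (1 + X)) * u` is constant.
  have hdu : d⁄dX K u = -u ^ 2 := by
    have h1 := congrArg (d⁄dX K) hu
    rw [Derivation.leibniz, map_add, derivative_one, derivative_X] at h1
    simp only [smul_eq_mul, zero_add, mul_one] at h1
    linear_combination u * h1 - d⁄dX K u * hu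
  have hg : (exp K).subst (log K) * u = 1 := by
    refine derivative.ext ?_ ?_
    · rw [Derivation.leibniz, derivative_subst hlog, derivative_exp, hdu, derivative_one, ← hu_def]
      simp only [smul_eq_mul]
      ring
    · rw [map_mul, map_one]
      have h2 : constantCoeff u = 1 := by
        have := congrArg (constantCoeff (R := K)) hu
        simpa using this
      rw [h2, mul_one, constantCoeff_subst_of_constantCoeff_eq_zero constantCoeff_log,
        constantCoeff_exp]
  linear_combination (1 + X) * hg - (exp K).subst (log K) * hu

/-- The identity `exp (c · log (1 + X) / d) = (1 + X) ^ q` for `c = q d`. -/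
theorem rescale_exp_subst_smul_log {c d : K} {q : ℕ} (h : c * d = q) :
    (rescale c (exp K)).subst (d • log K) = (1 + X) ^ q := by
  have hlog : HasSubst (log K) := HasSubst.log
  have h1 : HasSubst (d • log K) := hlog.smul' d
  have h2 : HasSubst (d • X : PowerSeries K) := HasSubst.smul_X' d
  have h3 : (d • log K) = (d • X : PowerSeries K).subst (log K) := by
    rw [subst_smul hlog, subst_X hlog]
  rw [h3, ← subst_comp_subst_apply h2 hlog, ← rescale_eq_subst, rescale_rescale, h,
    ← exp_pow_eq_rescale_exp, subst_pow hlog, exp_subst_log]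

theorem constantCoeff_rescale_exp_sub_one (c : K) :
    constantCoeff (rescale c (exp K) - 1) = 0 := by
  rw [map_sub, ← coeff_zero_eq_constantCoeff_apply, coeff_rescale]
  simp

/-- The identity `log (exp (c X)) = c X`, where `log` is a series in the argument minus one. -/
theorem log_subst_rescale_exp_sub_one (c : K) :
    (log K).subst (rescale c (exp K) - 1) = c • X := by
  have : CharZero K := algebraRat.charZero K
  have h0 := constantCoeff_rescale_exp_sub_one c
  have hs : HasSubst (rescale c (exp K) - 1) := .of_constantCoeff_zero' h0
  refine derivative.ext ?_ ?_
  · have hX : HasSubst (c • X : PowerSeries K) := .smul_X' c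
    have hu := congrArg (subst (rescale c (exp K) - 1)) (one_add_X_mul_deriv_log (K := K))
    have h1 : (1 : PowerSeries K).subst (rescale c (exp K) - 1) = 1 := by
      rw [← coe_substAlgHom hs, map_one]
    rw [subst_mul hs, subst_add hs, subst_X hs, h1, add_sub_cancel] at hu
    rw [derivative_subst hs, map_sub, derivative_one, sub_zero, rescale_eq_subst,
      derivative_subst hX, derivative_exp, ← rescale_eq_subst, Derivation.map_smul,
      derivative_X, smul_eq_C_mul, mul_one]
    linear_combination C c * hu
  · rw [constantCoeff_subst_of_constantCoeff_eq_zero h0, constantCoeff_log]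
    simp

/-- Composition with `d log (1 + X)` is injective since that series has the compositional inverse
`exp (X / d) - 1`. -/
theorem subst_smul_log_injective {d : K} (hd : d ≠ 0) {f : PowerSeries K}
    (h : f.subst (d • log K) = 0) : f = 0 := by
  have hs : HasSubst (d • log K) := HasSubst.log.smul' d
  have hs' : HasSubst (rescale d⁻¹ (exp K) - 1) :=
    .of_constantCoeff_zero' (constantCoeff_rescale_exp_sub_one _)
  have h1 := congrArg (subst (rescale d⁻¹ (exp K) - 1)) h
  rwa [subst_comp_subst_apply hs hs', subst_smul hs', log_subst_rescale_exp_sub_one, smul_smul,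
    mul_inv_cancel₀ hd, one_smul, X_subst, ← coe_substAlgHom hs', map_zero] at h1

end PowerSeries

/-! ### Estimates for the coefficients -/

namespace WeightSpace

variable {p : ℕ} [hp : Fact p.Prime]

theorem norm_natCast_padic (p : ℕ) [Fact p.Prime] {k : ℕ} (hk : k ≠ 0) :
    ‖(k : ℚ_[p])‖ = (p : ℝ) ^ (-(padicValNat p k : ℤ)) := by
  rw [Padic.norm_eq_zpow_neg_valuation (by exact_mod_cast hk), Padic.valuation_natCast]

theorem one_lt_p (p : ℕ) [hp : Fact p.Prime] : (1 : ℝ) < p := by exact_mod_cast hp.out.one_lt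

theorem two_le_p (p : ℕ) [hp : Fact p.Prime] : (2 : ℝ) ≤ p := by exact_mod_cast hp.out.two_le

theorem inv_norm_natCast_le (p : ℕ) [Fact p.Prime] {k : ℕ} (hk : k ≠ 0) :
    ‖(k : ℚ_[p])‖⁻¹ ≤ k := by
  rw [norm_natCast_padic p hk, zpow_neg, inv_inv, zpow_natCast]
  exact_mod_cast Nat.le_of_dvd (Nat.pos_of_ne_zero hk) pow_padicValNat_dvd

/-- Bernoulli's inequality for integer exponents. -/
theorem one_add_mul_le_zpow {x : ℝ} (hx : 2 ≤ x) (i : ℤ) : 1 + i * (x - 1) ≤ x ^ i := by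
  rcases le_or_gt 0 i with hi | hi
  · lift i to ℕ using hi
    have := one_add_mul_sub_le_pow (a := x) (by linarith) i
    rw [zpow_natCast]
    exact_mod_cast this
  · have h1 : (i : ℝ) ≤ -1 := by exact_mod_cast Int.le_sub_one_of_lt hi
    have h2 : 0 < x ^ i := zpow_pos (by linarith) i
    nlinarith

theorem weightRadius_pos (p : ℕ) [Fact p.Prime] (n : ℕ) : 0 < weightRadius p n := by
  have : (0 : ℝ≥0) < p := by exact_mod_cast (Nat.Prime.pos Fact.out)
  exact NNReal.rpow_pos this

theorem ballRadius_pos (p : ℕ) [Fact p.Prime] (n : ℕ) : 0 < ballRadius p n := by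
  have : (0 : ℝ≥0) < p := by exact_mod_cast (Nat.Prime.pos Fact.out)
  exact NNReal.rpow_pos this

theorem coe_weightRadius (p : ℕ) [Fact p.Prime] (n : ℕ) : (weightRadius p n : ℝ) =
    (p : ℝ) ^ (-(1 / ((p : ℝ) ^ ((n : ℤ) - 1) * ((p : ℝ) - 1)))) := by
  rw [weightRadius, NNReal.coe_rpow, NNReal.coe_natCast]

theorem coe_ballRadius (p : ℕ) [Fact p.Prime] (n : ℕ) : (ballRadius p n : ℝ) =
    (p : ℝ) ^ ((n : ℝ) - 1 / ((p : ℝ) - 1)) := by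
  rw [ballRadius, NNReal.coe_rpow, NNReal.coe_natCast]

theorem weightRadius_lt_one (p : ℕ) [Fact p.Prime] (n : ℕ) : (weightRadius p n : ℝ) < 1 := by
  have h1 := one_lt_p p
  rw [coe_weightRadius]
  refine Real.rpow_lt_one_of_one_lt_of_neg h1 (neg_neg_of_pos ?_)
  have : 0 < (p : ℝ) - 1 := by linarith
  positivity

theorem coe_weightRadius_zero (p : ℕ) [Fact p.Prime] :
    (weightRadius p 0 : ℝ) = (p : ℝ) ^ (-1 - 1 / ((p : ℝ) - 1)) := by
  have h1 := one_lt_p p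
  have h2 : 0 < (p : ℝ) - 1 := by linarith
  rw [coe_weightRadius]
  congr 1
  simp only [Nat.cast_zero, zero_sub, zpow_neg, zpow_one]
  field_simp
  ring

/-- The radii are chosen so that the `p ^ n`-th power of the radius of `𝒲⁰_n` is the radius of
`𝒲⁰_0`. -/
theorem weightRadius_pow (p : ℕ) [Fact p.Prime] (n : ℕ) :
    (weightRadius p n : ℝ) ^ (p ^ n) = weightRadius p 0 := by
  have h1 := one_lt_p p
  have h2 : 0 < (p : ℝ) - 1 := by linarith
  rw [coe_weightRadius, coe_weightRadius_zero, ← Real.rpow_natCast, ← Real.rpow_mul (by linarith)]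
  congr 1
  push_cast
  rw [zpow_sub_one₀ (by linarith), zpow_natCast]
  field_simp
  ring

/-- The bound for the `k`-th term of `log (1 + t)` on the disc of radius `weightRadius p n`; equality
holds for `k = p ^ (n - 1)` and `k = p ^ n`, so `weightRadius` and `ballRadius` match exactly. -/
theorem inv_norm_natCast_mul_weightRadius_pow_le (p : ℕ) [Fact p.Prime] (n : ℕ) {k : ℕ}
    (hk : k ≠ 0) : ‖(k : ℚ_[p])‖⁻¹ * (weightRadius p n : ℝ) ^ k ≤
      (p : ℝ) ^ ((n : ℝ) - 1 - 1 / ((p : ℝ) - 1)) := by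
  have h1 := one_lt_p p
  have h2 : 0 < (p : ℝ) - 1 := by linarith
  set v := padicValNat p k with hv
  have h3 : (p : ℝ) ^ v ≤ k := by
    exact_mod_cast Nat.le_of_dvd (Nat.pos_of_ne_zero hk) pow_padicValNat_dvd
  rw [norm_natCast_padic p hk, zpow_neg, inv_inv, zpow_natCast, coe_weightRadius,
    ← Real.rpow_natCast, ← Real.rpow_natCast _ k, ← Real.rpow_mul (by linarith),
    ← Real.rpow_add (by linarith)]
  refine Real.rpow_le_rpow_of_exponent_le h1.le ?_
  -- Bernoulli's inequality for the exponent `v - (n - 1)`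
  have h4 := one_add_mul_le_zpow (two_le_p p) ((v : ℤ) - ((n : ℤ) - 1))
  rw [zpow_sub₀ (by linarith)] at h4
  set D := (p : ℝ) ^ ((n : ℤ) - 1) with hD
  have hD0 : 0 < D := zpow_pos (by linarith) _
  rw [zpow_natCast, le_div_iff₀ hD0] at h4
  push_cast at h4
  have h5 : (v : ℝ) - ((n : ℝ) - 1) + 1 / ((p : ℝ) - 1) ≤ k / (D * ((p : ℝ) - 1)) := by
    rw [le_div_iff₀ (by positivity)]
    have : ((v : ℝ) - ((n : ℝ) - 1) + 1 / ((p : ℝ) - 1)) * (D * ((p : ℝ) - 1)) =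
        (1 + ((v : ℝ) - ((n : ℝ) - 1)) * ((p : ℝ) - 1)) * D := by
      field_simp
      ring
    rw [this]
    exact h4.trans h3
  have h6 : -(1 / (D * ((p : ℝ) - 1))) * k = -(k / (D * ((p : ℝ) - 1))) := by ring
  rw [h6]
  linarith

/-- The bound for the `k`-th term of the exponential on a disc of radius `p ^ (-1 - 1 / (p - 1))`,
from Legendre's formula for the valuation of `k !`. -/
theorem inv_norm_factorial_mul_pow_le (p : ℕ) [hp : Fact p.Prime] {k : ℕ} (hk : k ≠ 0) :
    ‖(k.factorial : ℚ_[p])‖⁻¹ * (weightRadius p 0 : ℝ) ^ k ≤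
      (p : ℝ) ^ (-(k : ℝ) - 1 / ((p : ℝ) - 1)) := by
  have h1 := one_lt_p p
  have h2 : 0 < (p : ℝ) - 1 := by linarith
  rw [norm_natCast_padic p k.factorial_ne_zero, zpow_neg, inv_inv, zpow_natCast,
    coe_weightRadius_zero, ← Real.rpow_natCast, ← Real.rpow_natCast _ k,
    ← Real.rpow_mul (by linarith), ← Real.rpow_add (by linarith)]
  refine Real.rpow_le_rpow_of_exponent_le h1.le ?_
  have h3 := sub_one_mul_padicValNat_factorial (p := p) k
  set v := padicValNat p k.factorial
  have h4 : (p - 1) * v + 1 ≤ k := by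
    have : (p.digits k).sum ≠ 0 := by
      intro h
      refine Nat.getLast_digit_ne_zero p hk ?_
      exact List.sum_eq_zero_iff.1 h _ (List.getLast_mem _)
    omega
  have h5 : ((p : ℝ) - 1) * v + 1 ≤ k := by
    have : ((p - 1 : ℕ) : ℝ) = (p : ℝ) - 1 := by
      rw [Nat.cast_sub hp.out.one_le, Nat.cast_one]
    rw [← this]
    exact_mod_cast h4
  have h6 : (v : ℝ) ≤ (k - 1) / ((p : ℝ) - 1) := by
    rw [le_div_iff₀ h2]; linarith
  have h7 : (-1 - 1 / ((p : ℝ) - 1)) * k = -k - (k - 1) / ((p : ℝ) - 1) - 1 / ((p : ℝ) - 1) := by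
    field_simp
    ring
  rw [h7]
  linarith

/-- No monomial of `(1 + t) ^ (p ^ n) - 1` exceeds its leading monomial `t ^ (p ^ n)` in Gauss norm. -/
theorem norm_choose_mul_weightRadius_pow_le (p : ℕ) [Fact p.Prime] (n : ℕ) {i : ℕ} (hi : i ≠ 0) :
    ‖((p ^ n).choose i : ℚ_[p])‖ * (weightRadius p n : ℝ) ^ i ≤ weightRadius p 0 := by
  have h1 := one_lt_p p
  have hi' : (i : ℚ_[p]) ≠ 0 := by exact_mod_cast hi
  -- `C(q, i) = (q / i) C(q - 1, i - 1)`
  have h2 : ((p ^ n).choose i : ℚ_[p]) =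
      (p : ℚ_[p]) ^ n * (i : ℚ_[p])⁻¹ * ((p ^ n - 1).choose (i - 1) : ℚ_[p]) := by
    have h := Nat.add_one_mul_choose_eq (p ^ n - 1) (i - 1)
    rw [Nat.sub_add_cancel (Nat.one_le_pow _ _ (Nat.Prime.pos Fact.out)),
      Nat.sub_add_cancel (Nat.one_le_iff_ne_zero.2 hi)] at h
    have h' := congrArg (Nat.cast (R := ℚ_[p])) h
    push_cast at h'
    field_simp
    linear_combination -h'
  have h3 : ‖((p ^ n - 1).choose (i - 1) : ℚ_[p])‖ ≤ 1 :=
    IsUltrametricDist.norm_natCast_le_one _ _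
  rw [h2, norm_mul, norm_mul, norm_pow, Padic.norm_p, norm_inv, coe_weightRadius_zero]
  have h4 := inv_norm_natCast_mul_weightRadius_pow_le p n hi
  calc (p : ℝ)⁻¹ ^ n * ‖(i : ℚ_[p])‖⁻¹ * ‖((p ^ n - 1).choose (i - 1) : ℚ_[p])‖ *
        (weightRadius p n : ℝ) ^ i
      ≤ (p : ℝ)⁻¹ ^ n * ‖(i : ℚ_[p])‖⁻¹ * 1 * (weightRadius p n : ℝ) ^ i := by gcongr
    _ = (p : ℝ)⁻¹ ^ n * (‖(i : ℚ_[p])‖⁻¹ * (weightRadius p n : ℝ) ^ i) := by ring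
    _ ≤ (p : ℝ)⁻¹ ^ n * (p : ℝ) ^ ((n : ℝ) - 1 - 1 / ((p : ℝ) - 1)) := by gcongr
    _ = (p : ℝ) ^ (-1 - 1 / ((p : ℝ) - 1)) := by
      rw [← Real.rpow_natCast, ← Real.rpow_neg_one, ← Real.rpow_mul (by linarith),
        ← Real.rpow_add (by linarith)]
      congr 1
      ring

end WeightSpace

/-! ### Characters of `ℤ_p^×` -/

namespace WeightSpace

variable {p : ℕ} [hp : Fact p.Prime]

/-- The continuous homomorphism `a ↦ (1 + r) ^ a` from `ℤ_p` to the units of `R`, for a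
topologically nilpotent element `r`. The additive group `ℤ_p` is written multiplicatively. -/
def powChar (p : ℕ) [Fact p.Prime] {R : Type*} [NormedRing R] [Algebra ℤ_[p] R]
    [IsBoundedSMul ℤ_[p] R] [IsUltrametricDist R] [CompleteSpace R] (r : R) (hr : Tendsto (r ^ ·) atTop (𝓝 0)) :
    Multiplicative ℤ_[p] →ₜ* Rˣ where
  toMonoidHom := (PadicInt.addChar_of_value_at_one (p := p) r hr).toMonoidHom.toHomUnits
  continuous_toFun := by
    have h := PadicInt.continuous_addChar_of_value_at_one (p := p) hr
    refine Units.continuous_iff.2 ⟨h, ?_⟩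
    have h2 : Continuous fun a : ℤ_[p] ↦ PadicInt.addChar_of_value_at_one r hr (-a) :=
      h.comp continuous_neg
    exact h2

theorem powChar_ofAdd_one {R : Type*} [NormedRing R] [Algebra ℤ_[p] R] [IsBoundedSMul ℤ_[p] R]
    [IsUltrametricDist R] [CompleteSpace R] (r : R) (hr : Tendsto (r ^ ·) atTop (𝓝 0)) :
    ((powChar p r hr (Multiplicative.ofAdd (1 : ℤ_[p])) : Rˣ) : R) = 1 + r :=
  PadicInt.addChar_of_value_at_one_def hr

theorem isClosed_dvd_sub_one (k : ℕ) :
    IsClosed {u : ℤ_[p]ˣ | (p : ℤ_[p]) ^ k ∣ (u : ℤ_[p]) - 1} := by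
  have : {u : ℤ_[p]ˣ | (p : ℤ_[p]) ^ k ∣ (u : ℤ_[p]) - 1} =
      {u : ℤ_[p]ˣ | ‖(u : ℤ_[p]) - 1‖ ≤ (p : ℝ) ^ (-k : ℤ)} := by
    ext u
    simp only [Set.mem_ofPred_eq]
    rw [PadicInt.norm_le_pow_iff_mem_span_pow, Ideal.mem_span_singleton]
  rw [this]
  exact isClosed_le (by fun_prop) continuous_const

/-- The unit `1 + p`. -/
def oneAddP (p : ℕ) [hp : Fact p.Prime] : ℤ_[p]ˣ :=
  IsUnit.unit (a := 1 + (p : ℤ_[p])) (by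
    rw [PadicInt.isUnit_iff]
    have h : ‖(p : ℤ_[p])‖ < ‖(1 : ℤ_[p])‖ := by
      rw [PadicInt.norm_p, norm_one]
      exact inv_lt_one_of_one_lt₀ (one_lt_p p)
    rw [IsUltrametricDist.norm_add_eq_max_of_norm_ne_norm h.ne', max_eq_left h.le, norm_one])

theorem coe_oneAddP : ((oneAddP p : ℤ_[p]ˣ) : ℤ_[p]) = 1 + p := rfl

variable {γ : ℤ_[p]ˣ}

theorem IsTopologicalGenerator.mem_closure (hγ : IsTopologicalGenerator p γ) {u : ℤ_[p]ˣ} :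
    u ∈ closure (Subgroup.zpowers γ : Set ℤ_[p]ˣ) ↔ (p : ℤ_[p]) ∣ (u : ℤ_[p]) - 1 := by
  rw [hγ]; rfl

theorem IsTopologicalGenerator.dvd (hγ : IsTopologicalGenerator p γ) :
    (p : ℤ_[p]) ∣ (γ : ℤ_[p]) - 1 :=
  hγ.mem_closure.1 (subset_closure (Subgroup.mem_zpowers γ))

theorem IsTopologicalGenerator.oneAddP_mem_closure (hγ : IsTopologicalGenerator p γ) :
    oneAddP p ∈ closure (Subgroup.zpowers γ : Set ℤ_[p]ˣ) := by
  rw [hγ.mem_closure, coe_oneAddP, add_sub_cancel_left]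

/-- A topological generator of `1 + p ℤ_p` is not congruent to `1` modulo `p ^ 2`. -/
theorem IsTopologicalGenerator.norm_sub_one (hγ : IsTopologicalGenerator p γ) :
    ‖(γ : ℤ_[p]) - 1‖ = (p : ℝ)⁻¹ := by
  have hp0 : (p : ℤ_[p]) ≠ 0 := by exact_mod_cast hp.out.ne_zero
  obtain ⟨a, ha⟩ := hγ.dvd
  have hna : ¬ (p : ℤ_[p]) ^ 2 ∣ (γ : ℤ_[p]) - 1 := by
    intro h
    -- otherwise all of `1 + p ℤ_p` would be contained in `1 + p ^ 2 ℤ_p`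
    have h1 : Subgroup.zpowers γ ≤
        (Units.map (Ideal.Quotient.mk (Ideal.span {(p : ℤ_[p]) ^ 2}) :
          ℤ_[p] →* ℤ_[p] ⧸ Ideal.span {(p : ℤ_[p]) ^ 2})).ker := by
      rw [Subgroup.zpowers_le, MonoidHom.mem_ker, Units.ext_iff]
      refine Ideal.Quotient.eq.2 ?_
      rwa [Ideal.mem_span_singleton]
    have h2 : (Subgroup.zpowers γ : Set ℤ_[p]ˣ) ⊆
        {u : ℤ_[p]ˣ | (p : ℤ_[p]) ^ 2 ∣ (u : ℤ_[p]) - 1} := by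
      intro u hu
      have := h1 hu
      rw [MonoidHom.mem_ker, Units.ext_iff] at this
      exact Ideal.mem_span_singleton.1 (Ideal.Quotient.eq.1 this)
    have h3 := closure_minimal h2 (isClosed_dvd_sub_one 2) hγ.oneAddP_mem_closure
    simp only [Set.mem_ofPred_eq, coe_oneAddP, add_sub_cancel_left] at h3
    have h4 := (pow_dvd_pow_iff hp0 PadicInt.prime_p.not_isUnit (n := 2) (m := 1)).1
      (by simpa using h3)
    omega
  have ha1 : ‖a‖ = 1 := by
    refine le_antisymm (PadicInt.norm_le_one a) (not_lt.1 fun h ↦ hna ?_)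
    obtain ⟨b, rfl⟩ := (PadicInt.norm_lt_one_iff_dvd a).1 h
    exact ⟨b, by rw [ha]; ring⟩
  rw [ha, norm_mul, ha1, mul_one, PadicInt.norm_p]

theorem IsTopologicalGenerator.tendsto_sub_one_pow (hγ : IsTopologicalGenerator p γ) :
    Tendsto (((γ : ℤ_[p]) - 1) ^ ·) atTop (𝓝 0) := by
  rw [tendsto_pow_atTop_nhds_zero_iff_norm_lt_one, hγ.norm_sub_one]
  exact inv_lt_one_of_one_lt₀ (one_lt_p p)

theorem powChar_ofAdd_natCast (hγ : Tendsto (((γ : ℤ_[p]) - 1) ^ ·) atTop (𝓝 0)) (k : ℕ) :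
    powChar p ((γ : ℤ_[p]) - 1) hγ (Multiplicative.ofAdd (k : ℤ_[p])) = γ ^ k := by
  have h1 : powChar p ((γ : ℤ_[p]) - 1) hγ (Multiplicative.ofAdd (1 : ℤ_[p])) = γ := by
    ext
    rw [powChar_ofAdd_one, add_sub_cancel]
  have h2 : Multiplicative.ofAdd (k : ℤ_[p]) = Multiplicative.ofAdd (1 : ℤ_[p]) ^ k := by
    rw [← ofAdd_nsmul, nsmul_one]
  rw [h2, map_pow, h1]

/-- The image of `a ↦ γ ^ a` is compact, hence it is the closed subgroup generated by `γ`. -/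
theorem range_powChar (hγ : Tendsto (((γ : ℤ_[p]) - 1) ^ ·) atTop (𝓝 0)) :
    Set.range (powChar p ((γ : ℤ_[p]) - 1) hγ) = closure (Subgroup.zpowers γ : Set ℤ_[p]ˣ) := by
  set κ := powChar p ((γ : ℤ_[p]) - 1) hγ with hκ
  have hd : DenseRange fun k : ℕ ↦ Multiplicative.ofAdd (k : ℤ_[p]) := PadicInt.denseRange_natCast
  refine subset_antisymm ?_ ?_
  · rintro _ ⟨a, rfl⟩
    refine hd.induction_on (p := fun a ↦ κ a ∈ closure (Subgroup.zpowers γ : Set ℤ_[p]ˣ)) a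
      (isClosed_closure.preimage κ.continuous_toFun) fun k ↦ subset_closure ?_
    rw [powChar_ofAdd_natCast]
    exact Subgroup.npow_mem_zpowers γ k
  · have : CompactSpace (Multiplicative ℤ_[p]) := inferInstanceAs (CompactSpace ℤ_[p])
    refine closure_minimal ?_ (isCompact_range κ.continuous_toFun).isClosed
    have : Subgroup.zpowers γ ≤ (κ : Multiplicative ℤ_[p] →* ℤ_[p]ˣ).range := by
      rw [Subgroup.zpowers_le]
      refine ⟨Multiplicative.ofAdd (1 : ℤ_[p]), ?_⟩
      have := powChar_ofAdd_natCast hγ 1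
      rwa [Nat.cast_one, pow_one] at this
    exact this

/-- The homomorphism `a ↦ γ ^ a` is injective since the subgroup topologically generated by `γ` is
not torsion. -/
theorem IsTopologicalGenerator.powChar_injective (hγ : IsTopologicalGenerator p γ) :
    Function.Injective (powChar p ((γ : ℤ_[p]) - 1) hγ.tendsto_sub_one_pow) := by
  set κ := powChar p ((γ : ℤ_[p]) - 1) hγ.tendsto_sub_one_pow with hκ
  refine (injective_iff_map_eq_one κ).2 fun a ha ↦ ?_
  by_contra ha0
  have ha0' : a.toAdd ≠ 0 := ha0
  have hd : DenseRange fun k : ℕ ↦ (k : ℤ_[p]) := PadicInt.denseRange_natCast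
  -- The kernel is closed, hence an ideal of `ℤ_p`; if it is not zero, it contains some `p ^ k`.
  have hmul (b : ℤ_[p]) : κ (Multiplicative.ofAdd (a.toAdd * b)) = 1 := by
    refine hd.induction_on (p := fun b ↦ κ (Multiplicative.ofAdd (a.toAdd * b)) = 1) b ?_ fun k ↦ ?_
    · refine isClosed_eq (κ.continuous_toFun.comp ?_) continuous_const
      exact (continuous_const.mul continuous_id : Continuous fun b : ℤ_[p] ↦ a.toAdd * b)
    · have : Multiplicative.ofAdd (a.toAdd * (k : ℤ_[p])) = a ^ k := by
        rw [mul_comm, ← nsmul_eq_mul, ofAdd_nsmul, ofAdd_toAdd]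
      rw [this, map_pow, ha, one_pow]
  have h1 := hmul ((PadicInt.unitCoeff ha0')⁻¹ : ℤ_[p]ˣ)
  have h2 : a.toAdd * ((PadicInt.unitCoeff ha0')⁻¹ : ℤ_[p]ˣ) =
      ((p ^ a.toAdd.valuation : ℕ) : ℤ_[p]) := by
    rw [Units.mul_inv_eq_iff_eq_mul, Nat.cast_pow, mul_comm]
    exact PadicInt.unitCoeff_spec ha0'
  rw [h2, powChar_ofAdd_natCast] at h1
  set N := p ^ a.toAdd.valuation with hN
  have hN0 : N ≠ 0 := pow_ne_zero _ hp.out.ne_zero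
  have h3 : closure (Subgroup.zpowers γ : Set ℤ_[p]ˣ) ⊆ {u | u ^ N = 1} := by
    refine closure_minimal ?_ (isClosed_eq (by fun_prop) continuous_const)
    rintro _ ⟨k, rfl⟩
    change (γ ^ k) ^ N = 1
    rw [← zpow_natCast, ← zpow_mul, mul_comm, zpow_mul, zpow_natCast, h1, one_zpow]
  have h4 : oneAddP p ^ N = 1 := h3 hγ.oneAddP_mem_closure
  have h5 := congrArg (Units.val) h4
  rw [Units.val_pow_eq_pow_val, coe_oneAddP, Units.val_one] at h5
  have h6 : (1 + p) ^ N = 1 := by exact_mod_cast h5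
  have h7 := (Nat.pow_eq_one.1 h6).resolve_right hN0
  have := hp.out.pos
  omega

theorem dvd_units_pow_sub_one (u : ℤ_[p]ˣ) :
    (p : ℤ_[p]) ∣ ((u ^ (p - 1) : ℤ_[p]ˣ) : ℤ_[p]) - 1 := by
  rw [← Ideal.mem_span_singleton, ← PadicInt.maximalIdeal_eq_span_p, ← PadicInt.ker_toZMod,
    RingHom.mem_ker, map_sub, map_one, Units.val_pow_eq_pow_val, map_pow, sub_eq_zero]
  refine ZMod.pow_card_sub_one_eq_one ?_
  exact (u.isUnit.map PadicInt.toZMod).ne_zero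

/-- The inverse `l` of `a ↦ γ ^ a`, extended to `ℤ_p^×` by the trivial map on the roots of unity. It
is characterized by `(γ ^ l(u)) ^ (p - 1) = u ^ (p - 1)`, as `u ^ (p - 1)` lies in `1 + p ℤ_p`. -/
theorem IsTopologicalGenerator.exists_log (hγ : IsTopologicalGenerator p γ) :
    ∃ l : ℤ_[p]ˣ →ₜ* Multiplicative ℤ_[p],
      (∀ u, powChar p ((γ : ℤ_[p]) - 1) hγ.tendsto_sub_one_pow (l u) ^ (p - 1) = u ^ (p - 1)) ∧
      l γ = Multiplicative.ofAdd 1 ∧ ∀ u, u ^ (p - 1) = 1 → l u = 1 := by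
  set κ := powChar p ((γ : ℤ_[p]) - 1) hγ.tendsto_sub_one_pow with hκ
  have hp1 : p - 1 ≠ 0 := by have := hp.out.two_le; omega
  have : CompactSpace (Multiplicative ℤ_[p]) := inferInstanceAs (CompactSpace ℤ_[p])
  -- `a ↦ γ ^ ((p - 1) a)` is a closed embedding whose image contains all `u ^ (p - 1)`.
  let κ' : Multiplicative ℤ_[p] →* ℤ_[p]ˣ := (powMonoidHom (p - 1)).comp κ
  have hκ' (a) : κ' a = κ a ^ (p - 1) := rfl
  have hinj : Function.Injective κ' := by
    refine (injective_iff_map_eq_one κ').2 fun a ha ↦ ?_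
    rw [hκ', ← map_pow] at ha
    have h1 := (injective_iff_map_eq_one κ).1 hγ.powChar_injective _ ha
    have h2 : (p - 1) • a.toAdd = 0 := h1
    exact (smul_eq_zero.1 h2).resolve_left hp1
  have hcont : Continuous κ' := (continuous_pow (p - 1)).comp κ.continuous_toFun
  have hemb : IsClosedEmbedding κ' := hcont.isClosedEmbedding hinj
  have hunit : IsUnit ((p - 1 : ℕ) : ℤ_[p]) := by
    rw [PadicInt.isUnit_iff]
    refine le_antisymm (PadicInt.norm_le_one _) (not_lt.1 fun h ↦ ?_)
    have h1 : ‖((p - 1 : ℕ) : ℤ_[p])‖ = ‖(((p - 1 : ℕ) : ℤ) : ℤ_[p])‖ := by rw [Int.cast_natCast]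
    rw [h1, PadicInt.norm_int_lt_one_iff_dvd] at h
    have := Nat.le_of_dvd (Nat.pos_of_ne_zero hp1) (Int.natCast_dvd_natCast.1 h)
    omega
  have hsurj (u : ℤ_[p]ˣ) : ∃ a, κ' a = u ^ (p - 1) := by
    have h1 : u ^ (p - 1) ∈ Set.range κ := by
      rw [range_powChar, hγ.mem_closure]
      exact dvd_units_pow_sub_one u
    obtain ⟨b, hb⟩ := h1
    refine ⟨Multiplicative.ofAdd (hunit.unit⁻¹ * b.toAdd), ?_⟩
    have h2 : (Multiplicative.ofAdd ((hunit.unit⁻¹ : ℤ_[p]ˣ) * b.toAdd)) ^ (p - 1) = b := by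
      rw [← ofAdd_nsmul, nsmul_eq_mul, ← mul_assoc, IsUnit.mul_val_inv, one_mul, ofAdd_toAdd]
    rw [hκ', ← map_pow, h2, hb]
  choose l hl using hsurj
  refine ⟨⟨⟨⟨l, hinj ?_⟩, fun u v ↦ hinj ?_⟩, ?_⟩, hl, hinj ?_, fun u hu ↦ hinj ?_⟩
  · rw [hl, map_one, one_pow]
  · simp only [map_mul, hl, mul_pow]
  · change Continuous l
    rw [hemb.isInducing.continuous_iff]
    have : κ' ∘ l = fun u ↦ u ^ (p - 1) := funext hl
    rw [this]
    fun_prop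
  · refine (hl γ).trans ?_
    have := powChar_ofAdd_natCast hγ.tendsto_sub_one_pow 1
    rw [Nat.cast_one, pow_one] at this
    rw [hκ', hκ, this]
  · refine (hl u).trans ?_
    rw [hu, map_one]

/-- The character is `u ↦ (1 + z) ^ l(u)`, where `l` is the logarithm to the base `γ`. -/
theorem IsTopologicalGenerator.exists_character (hγ : IsTopologicalGenerator p γ) {L : Type*}
    [NormedField L] [NormedAlgebra ℚ_[p] L] [CompleteSpace L] {z : L} (hz : ‖z‖ < 1) :
    ∃ ψ : ℤ_[p]ˣ →ₜ* Lˣ, (∀ u : ℤ_[p]ˣ, u ^ (p - 1) = 1 → ψ u = 1) ∧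
      ((ψ γ : Lˣ) : L) = 1 + z := by
  obtain ⟨l, -, h1, h2⟩ := hγ.exists_log
  have : IsUltrametricDist L := IsUltrametricDist.of_normedAlgebra ℚ_[p]
  let : Algebra ℤ_[p] L := Algebra.compHom L (algebraMap ℤ_[p] ℚ_[p])
  have : IsBoundedSMul ℤ_[p] L := .of_norm_smul_le fun a x ↦
    norm_smul_le (algebraMap ℤ_[p] ℚ_[p] a) x
  have hz' : Tendsto (z ^ ·) atTop (𝓝 0) := tendsto_pow_atTop_nhds_zero_iff_norm_lt_one.2 hz
  refine ⟨(powChar p z hz').comp l, fun u hu ↦ ?_, ?_⟩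
  · change powChar p z hz' (l u) = 1
    rw [h2 u hu, map_one]
  · change ((powChar p z hz' (l γ) : Lˣ) : L) = _
    rw [h1, powChar_ofAdd_one]

/-- A continuous character trivial on the roots of unity is determined by its value at `γ`. -/
theorem IsTopologicalGenerator.character_ext (hγ : IsTopologicalGenerator p γ) {G : Type*}
    [CommGroup G] [TopologicalSpace G] [T2Space G] {ψ ψ' : ℤ_[p]ˣ →ₜ* G}
    (h : ∀ u : ℤ_[p]ˣ, u ^ (p - 1) = 1 → ψ u = 1) (h' : ∀ u : ℤ_[p]ˣ, u ^ (p - 1) = 1 → ψ' u = 1)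
    (heq : ψ γ = ψ' γ) : ψ = ψ' := by
  obtain ⟨l, h1, -, -⟩ := hγ.exists_log
  set κ := powChar p ((γ : ℤ_[p]) - 1) hγ.tendsto_sub_one_pow
  have hcl : closure (Subgroup.zpowers γ : Set ℤ_[p]ˣ) ⊆ {u | ψ u = ψ' u} := by
    refine closure_minimal ?_ (isClosed_eq ψ.continuous_toFun ψ'.continuous_toFun)
    rintro _ ⟨k, rfl⟩
    change ψ (γ ^ k) = ψ' (γ ^ k)
    rw [map_zpow, map_zpow, heq]
  ext u
  -- `u` is the product of a root of unity and `γ ^ l(u)`.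
  have h2 : (u / κ (l u)) ^ (p - 1) = 1 := by rw [div_pow, h1, div_self']
  have h3 : ψ (κ (l u)) = ψ' (κ (l u)) := by
    refine hcl ?_
    rw [← range_powChar hγ.tendsto_sub_one_pow]
    exact ⟨l u, rfl⟩
  have h4 := h _ h2
  have h5 := h' _ h2
  rw [map_div, div_eq_one] at h4 h5
  rw [h4, h5, h3]

/-- For odd `p`, the leading term of `log γ` dominates. -/
theorem IsTopologicalGenerator.norm_logGen (hγ : IsTopologicalGenerator p γ) (hp2 : p ≠ 2) :
    ‖logGen γ‖ = (p : ℝ)⁻¹ := by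
  have h3 : (3 : ℝ) ≤ p := by
    have := hp.out.two_le
    exact_mod_cast (show 3 ≤ p by omega)
  set x : ℚ_[p] := ((γ : ℤ_[p]) : ℚ_[p]) - 1 with hx
  have hxn : ‖x‖ = (p : ℝ)⁻¹ := by
    rw [← hγ.norm_sub_one, PadicInt.norm_def]
    rfl
  set u : ℕ → ℚ_[p] := fun k ↦ (-1) ^ k * x ^ (k + 1) / ((k : ℚ_[p]) + 1) with hu
  have hb (k : ℕ) : ‖u k‖ ≤ (p : ℝ)⁻¹ * (2 / 3) ^ k := by
    have h1 := inv_norm_natCast_le p (k := k + 1) (by omega)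
    have h2 : (((k + 1 : ℕ) : ℕ) : ℝ) ≤ 2 ^ k := by exact_mod_cast Nat.lt_two_pow_self (n := k)
    have h4 : ‖u k‖ = ‖((k + 1 : ℕ) : ℚ_[p])‖⁻¹ * (p : ℝ)⁻¹ ^ (k + 1) := by
      simp only [hu, norm_div, norm_mul, norm_pow, norm_neg, norm_one, one_pow, one_mul, hxn]
      push_cast
      ring
    rw [h4]
    calc _ ≤ 2 ^ k * (p : ℝ)⁻¹ ^ (k + 1) := by gcongr; exact h1.trans h2
      _ = (p : ℝ)⁻¹ * (2 * (p : ℝ)⁻¹) ^ k := by ring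
      _ ≤ (p : ℝ)⁻¹ * (2 / 3) ^ k := by
        gcongr
        rw [div_eq_mul_inv]
        gcongr
  have hsum : Summable u := by
    refine Summable.of_norm_bounded ?_ hb
    exact (summable_geometric_of_lt_one (by norm_num) (by norm_num)).mul_left _
  have hlog : logGen γ = ∑' k, u k := rfl
  have hu0 : u 0 = x := by simp [hu]
  have hp0 : (0 : ℝ) < (p : ℝ)⁻¹ := by positivity
  have htail : ‖∑' k, u (k + 1)‖ < ‖x‖ := by
    have h1 : ‖∑' k, u (k + 1)‖ ≤ (p : ℝ)⁻¹ * (2 / 3) := by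
      refine IsUltrametricDist.norm_tsum_le_of_forall_le fun k ↦ (hb (k + 1)).trans ?_
      gcongr
      exact pow_le_of_le_one (by norm_num) (by norm_num) (by omega)
    rw [hxn]
    linarith
  rw [hlog, hsum.tsum_eq_zero_add, hu0,
    IsUltrametricDist.norm_add_eq_max_of_norm_ne_norm htail.ne', max_eq_left htail.le, hxn]

end WeightSpace

/-! ### The logarithm and exponential as functions on discs -/

namespace WeightSpace

variable {p : ℕ} [hp : Fact p.Prime] {n : ℕ}

instance instT2SpaceWeightAlg : T2Space (TateDisk ℚ_[p] (weightRadius p n)) :=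
  TateDisk.t2Space (weightRadius_pos p n)

instance instT2SpaceBallAlg : T2Space (TateDisk ℚ_[p] (ballRadius p n)) :=
  TateDisk.t2Space (ballRadius_pos p n)

instance instCompleteSpaceWeightAlg : CompleteSpace (TateDisk ℚ_[p] (weightRadius p n)) :=
  TateDisk.completeSpace (weightRadius_pos p n)

instance instCompleteSpaceBallAlg : CompleteSpace (TateDisk ℚ_[p] (ballRadius p n)) :=
  TateDisk.completeSpace (ballRadius_pos p n)

theorem norm_coeff_log {k : ℕ} (hk : k ≠ 0) :
    ‖PowerSeries.coeff k (PowerSeries.log ℚ_[p])‖ = ‖(k : ℚ_[p])‖⁻¹ := by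
  rw [PowerSeries.coeff_log, if_neg hk]
  simp

theorem tendsto_coeff_log (p : ℕ) [hp : Fact p.Prime] (n : ℕ) :
    Tendsto (fun k : ℕ ↦ ‖PowerSeries.coeff k (PowerSeries.log ℚ_[p])‖ *
      (weightRadius p n : ℝ) ^ k) atTop (𝓝 0) := by
  refine squeeze_zero (fun k ↦ by positivity) (fun k ↦ ?_)
    (tendsto_self_mul_const_pow_of_lt_one (NNReal.coe_nonneg _) (weightRadius_lt_one p n))
  rcases eq_or_ne k 0 with rfl | hk
  · simp
  · rw [norm_coeff_log hk]
    gcongr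
    exact inv_norm_natCast_le p hk

/-- The function `log (1 + t)` on `𝒲⁰_n`. -/
def logFun (p : ℕ) [hp : Fact p.Prime] (n : ℕ) : weightAlg p n :=
  TateDisk.mk (PowerSeries.log ℚ_[p]) (tendsto_coeff_log p n)

theorem norm_logFun_le (p : ℕ) [hp : Fact p.Prime] (n : ℕ) :
    ‖logFun p n‖ ≤ (p : ℝ) ^ ((n : ℝ) - 1 - 1 / ((p : ℝ) - 1)) := by
  refine TateDisk.norm_le fun k ↦ ?_
  rw [TateDisk.coeff_def, logFun, TateDisk.toPowerSeries_mk]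
  rcases eq_or_ne k 0 with rfl | hk
  · have := one_lt_p p
    simp only [PowerSeries.coeff_log, if_true, norm_zero, zero_mul]
    positivity
  · rw [norm_coeff_log hk]
    exact inv_norm_natCast_mul_weightRadius_pow_le p n hk

/-- The function `log (1 + t) / g` on `𝒲⁰_n`, which is `ϑ` for `g = log γ`. -/
def thetaFun (n : ℕ) (g : ℚ_[p]) : weightAlg p n := algebraMap ℚ_[p] _ g⁻¹ * logFun p n

theorem toPowerSeries_thetaFun (g : ℚ_[p]) :
    (thetaFun n g).toPowerSeries = g⁻¹ • PowerSeries.log ℚ_[p] := by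
  rw [PowerSeries.smul_eq_C_mul]
  rfl

theorem norm_thetaFun_le {g : ℚ_[p]} (hg : ‖g‖ = (p : ℝ)⁻¹) :
    ‖thetaFun n g‖ ≤ ballRadius p n := by
  have h1 := one_lt_p p
  refine (norm_mul_le _ _).trans ?_
  have h2 : ‖algebraMap ℚ_[p] (weightAlg p n) g⁻¹‖ ≤ p :=
    (TateDisk.norm_algebraMap_le _).trans (by rw [norm_inv, hg, inv_inv])
  calc _ ≤ (p : ℝ) * (p : ℝ) ^ ((n : ℝ) - 1 - 1 / ((p : ℝ) - 1)) :=
        mul_le_mul h2 (norm_logFun_le p n) (norm_nonneg _) (by positivity)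
    _ = ballRadius p n := by
      rw [coe_ballRadius]
      nth_rewrite 1 [← Real.rpow_one (p : ℝ)]
      rw [← Real.rpow_add (by linarith)]
      congr 1
      ring

/-- The pullback `B → A` along `ϑ = log (1 + t) / g`. Only the norm of `g = log γ` matters. -/
def thetaPullback (n : ℕ) {g : ℚ_[p]} (hg : ‖g‖ = (p : ℝ)⁻¹) :
    ballAlg p n →A[ℚ_[p]] weightAlg p n :=
  TateDisk.evalAlgHom TateDisk.norm_algebraMap_le (thetaFun n g) (norm_thetaFun_le hg)

theorem thetaPullback_s {g : ℚ_[p]} (hg : ‖g‖ = (p : ℝ)⁻¹) :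
    thetaPullback n hg (s p n) = thetaFun n g := TateDisk.evalAlgHom_coord _ _

theorem toPowerSeries_thetaPullback {g : ℚ_[p]} (hg : ‖g‖ = (p : ℝ)⁻¹) (b : ballAlg p n) :
    (thetaPullback n hg b).toPowerSeries =
      b.toPowerSeries.subst (g⁻¹ • PowerSeries.log ℚ_[p]) := by
  rw [← toPowerSeries_thetaFun (n := n)]
  refine TateDisk.toPowerSeries_evalHom (weightRadius_pos p n) _ _ ?_ b
  rw [toPowerSeries_thetaFun, PowerSeries.smul_eq_C_mul, map_mul, PowerSeries.constantCoeff_log,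
    mul_zero]

theorem thetaPullback_injective {g : ℚ_[p]} (hg : ‖g‖ = (p : ℝ)⁻¹) :
    Function.Injective (thetaPullback n hg) := by
  have hg0 : g ≠ 0 := by
    rintro rfl
    rw [norm_zero] at hg
    exact (inv_ne_zero (by exact_mod_cast hp.out.ne_zero)) hg.symm
  refine (injective_iff_map_eq_zero _).2 fun b hb ↦ TateDisk.ext ?_
  refine PowerSeries.subst_smul_log_injective (inv_ne_zero hg0) ?_
  rw [← toPowerSeries_thetaPullback hg, hb]
  rfl

theorem norm_coeff_exp_mul_le {g : ℚ_[p]} (hg : ‖g‖ = (p : ℝ)⁻¹) {k : ℕ} (hk : k ≠ 0) :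
    ‖PowerSeries.coeff k (PowerSeries.rescale ((p : ℚ_[p]) ^ n * g) (PowerSeries.exp ℚ_[p]))‖ *
      (ballRadius p n : ℝ) ^ k ≤ (p : ℝ) ^ (-(k : ℝ) - 1 / ((p : ℝ) - 1)) := by
  have h1 := one_lt_p p
  refine le_trans (le_of_eq ?_) (inv_norm_factorial_mul_pow_le p hk)
  have h2 : ‖(p : ℚ_[p]) ^ n * g‖ * ballRadius p n = weightRadius p 0 := by
    rw [norm_mul, norm_pow, Padic.norm_p, hg, coe_ballRadius, coe_weightRadius_zero,
      ← pow_succ, ← Real.rpow_natCast, ← Real.rpow_neg_one, ← Real.rpow_mul (by linarith),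
      ← Real.rpow_add (by linarith)]
    congr 1
    push_cast
    ring
  rw [PowerSeries.coeff_rescale, PowerSeries.coeff_exp, norm_mul, norm_pow, ← h2]
  rw [one_div, map_inv₀, map_natCast, norm_inv]
  ring

theorem tendsto_coeff_exp {g : ℚ_[p]} (hg : ‖g‖ = (p : ℝ)⁻¹) :
    Tendsto (fun k : ℕ ↦ ‖PowerSeries.coeff k (PowerSeries.rescale ((p : ℚ_[p]) ^ n * g)
      (PowerSeries.exp ℚ_[p]))‖ * (ballRadius p n : ℝ) ^ k) atTop (𝓝 0) := by
  have h1 := one_lt_p p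
  have h2 : Tendsto (fun k : ℕ ↦ (p : ℝ)⁻¹ ^ k) atTop (𝓝 0) :=
    tendsto_pow_atTop_nhds_zero_of_lt_one (by positivity) (inv_lt_one_of_one_lt₀ h1)
  refine squeeze_zero' (Eventually.of_forall fun k ↦ by positivity) ?_ h2
  filter_upwards [eventually_ne_atTop 0] with k hk
  refine (norm_coeff_exp_mul_le hg hk).trans ?_
  rw [← Real.rpow_natCast, ← Real.rpow_neg_one, ← Real.rpow_mul (by linarith)]
  refine Real.rpow_le_rpow_of_exponent_le h1.le ?_
  have : 0 ≤ 1 / ((p : ℝ) - 1) := one_div_nonneg.2 (by linarith)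
  linarith

/-- The function `exp (p ^ n g s)` on the ball of radius `p ^ (n - 1 / (p - 1))`. -/
def expFun (n : ℕ) {g : ℚ_[p]} (hg : ‖g‖ = (p : ℝ)⁻¹) : ballAlg p n :=
  TateDisk.mk (PowerSeries.rescale ((p : ℚ_[p]) ^ n * g) (PowerSeries.exp ℚ_[p]))
    (tendsto_coeff_exp hg)

theorem toPowerSeries_expFun {g : ℚ_[p]} (hg : ‖g‖ = (p : ℝ)⁻¹) : (expFun n hg).toPowerSeries =
    PowerSeries.rescale ((p : ℚ_[p]) ^ n * g) (PowerSeries.exp ℚ_[p]) := rfl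

theorem toPowerSeries_expFun_sub_one {g : ℚ_[p]} (hg : ‖g‖ = (p : ℝ)⁻¹) :
    (expFun n hg - 1).toPowerSeries =
      PowerSeries.rescale ((p : ℚ_[p]) ^ n * g) (PowerSeries.exp ℚ_[p]) - 1 := rfl

theorem norm_expFun_sub_one_le {g : ℚ_[p]} (hg : ‖g‖ = (p : ℝ)⁻¹) :
    ‖expFun n hg - 1‖ ≤ weightRadius p 0 := by
  have h1 := one_lt_p p
  refine TateDisk.norm_le fun k ↦ ?_
  rw [TateDisk.coeff_def, toPowerSeries_expFun_sub_one]
  rcases eq_or_ne k 0 with rfl | hk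
  · rw [PowerSeries.coeff_zero_eq_constantCoeff_apply,
      PowerSeries.constantCoeff_rescale_exp_sub_one, norm_zero, zero_mul]
    positivity
  · rw [map_sub, PowerSeries.coeff_one, if_neg hk, sub_zero]
    refine (norm_coeff_exp_mul_le hg hk).trans ?_
    rw [coe_weightRadius_zero]
    refine Real.rpow_le_rpow_of_exponent_le h1.le ?_
    have : (1 : ℝ) ≤ k := by exact_mod_cast Nat.one_le_iff_ne_zero.2 hk
    linarith

/-- The function `(1 + t) ^ (p ^ n) = exp (p ^ n log (1 + t))` descends to the ball. -/
theorem thetaPullback_expFun {g : ℚ_[p]} (hg : ‖g‖ = (p : ℝ)⁻¹) (hg0 : g ≠ 0) :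
    thetaPullback n hg (expFun n hg) = (1 + t p n) ^ (p ^ n) := by
  refine TateDisk.ext ?_
  rw [toPowerSeries_thetaPullback, toPowerSeries_expFun,
    PowerSeries.rescale_exp_subst_smul_log (q := p ^ n) (by field_simp; push_cast; rfl)]
  rfl

/-- Since `s = log (exp (p ^ n g s)) / (p ^ n g)`, a continuous homomorphism out of the algebra of
the ball is determined by the image of `exp (p ^ n g s)`. -/
theorem ballAlg_ringHom_ext {g : ℚ_[p]} (hg : ‖g‖ = (p : ℝ)⁻¹) (hg0 : g ≠ 0)
    {R : Type*} [Ring R] [TopologicalSpace R] [T2Space R] {f f' : ballAlg p n →+* R}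
    (hf : Continuous f) (hf' : Continuous f')
    (hK : ∀ a, f (algebraMap ℚ_[p] _ a) = f' (algebraMap ℚ_[p] _ a))
    (hE : f (expFun n hg) = f' (expFun n hg)) : f = f' := by
  set c : ℚ_[p] := (p : ℚ_[p]) ^ n * g with hc
  have hc0 : c ≠ 0 := mul_ne_zero (pow_ne_zero _ (by exact_mod_cast hp.out.ne_zero)) hg0
  let ev : weightAlg p 0 →+* ballAlg p n := TateDisk.evalHom (algebraMap ℚ_[p] (ballAlg p n))
    TateDisk.norm_algebraMap_le (expFun n hg - 1) (norm_expFun_sub_one_le hg)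
  have hev : Continuous ev := TateDisk.continuous_evalHom _ _
  have h1 : f.comp ev = f'.comp ev := by
    refine TateDisk.ringHom_ext (hf.comp hev) (hf'.comp hev) (fun a ↦ ?_) ?_
    · simp only [RingHom.comp_apply, ev, TateDisk.evalHom_algebraMap, hK]
    · simp only [RingHom.comp_apply, ev, TateDisk.evalHom_coord, map_sub, hE, map_one]
  have h2 : ev (logFun p 0) = algebraMap ℚ_[p] _ c * s p n := by
    refine TateDisk.ext ?_
    refine (TateDisk.toPowerSeries_evalHom (ballRadius_pos p n) _ _
      (PowerSeries.constantCoeff_rescale_exp_sub_one _) _).trans ?_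
    · rw [toPowerSeries_expFun_sub_one, logFun, TateDisk.toPowerSeries_mk,
        PowerSeries.log_subst_rescale_exp_sub_one, PowerSeries.smul_eq_C_mul]
      rfl
  refine TateDisk.ringHom_ext hf hf' hK ?_
  have h3 := DFunLike.congr_fun h1 (logFun p 0)
  rw [RingHom.comp_apply, RingHom.comp_apply, h2] at h3
  have h4 : s p n = algebraMap ℚ_[p] _ c⁻¹ * (algebraMap ℚ_[p] _ c * s p n) := by
    rw [← mul_assoc, ← map_mul, inv_mul_cancel₀ hc0, map_one, one_mul]
  change f (s p n) = f' (s p n)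
  rw [h4, map_mul f, map_mul f', hK, h3]

/-! ### Points with values in complete extensions -/

theorem evalAlgHom_thetaFun {L : Type*} [NormedField L] [NormedAlgebra ℚ_[p] L] [CompleteSpace L]
    [IsUltrametricDist L] (hi : ∀ a, ‖algebraMap ℚ_[p] L a‖ ≤ ‖a‖) {z : L}
    (hz : ‖z‖ ≤ weightRadius p n) (g : ℚ_[p]) :
    TateDisk.evalAlgHom hi z hz (thetaFun n g) = logOneAdd z / algebraMap ℚ_[p] L g := by
  have h1 := TateDisk.summable_eval hi hz (thetaFun n g)
  rw [TateDisk.evalAlgHom_apply, TateDisk.evalHom_apply, h1.tsum_eq_zero_add, logOneAdd,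
    div_eq_mul_inv, mul_comm (tsum _), ← tsum_mul_left]
  simp only [TateDisk.coeff_def, toPowerSeries_thetaFun]
  rw [map_smul, PowerSeries.coeff_log, if_pos rfl, smul_zero, map_zero, zero_mul, zero_add]
  refine tsum_congr fun k ↦ ?_
  rw [map_smul, PowerSeries.coeff_log, if_neg k.succ_ne_zero, smul_eq_mul, map_mul, map_inv₀]
  simp only [map_div₀, map_pow, map_neg, map_one, map_natCast]
  push_cast
  ring

/-- A continuous homomorphism to a valued field maps topologically nilpotent elements to such
elements; applied to `p (p ^ (-p) t ^ d) ^ m` this bounds the value at the coordinate `t`. -/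
theorem norm_algHom_t_le {L : Type*} [NormedField L] [NormedAlgebra ℚ_[p] L]
    (e : weightAlg p n →A[ℚ_[p]] L) : ‖e (t p n)‖ ≤ weightRadius p n := by
  have h1 := one_lt_p p
  by_contra! hlt
  set z := e (t p n) with hz
  set d := p ^ n * (p - 1) with hd
  have hd0 : d ≠ 0 := mul_ne_zero (pow_ne_zero _ hp.out.ne_zero) (by have := hp.out.two_le; omega)
  -- A power of the radius is a value of the norm of `ℚ_p`.
  have hrad : (weightRadius p n : ℝ) ^ d = ((p : ℝ) ^ p)⁻¹ := by
    have h2 : ((p - 1 : ℕ) : ℝ) = (p : ℝ) - 1 := by rw [Nat.cast_sub hp.out.one_le, Nat.cast_one]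
    have h3 : (p : ℝ) - 1 ≠ 0 := by linarith
    rw [hd, pow_mul, weightRadius_pow, coe_weightRadius_zero, ← Real.rpow_natCast,
      ← Real.rpow_mul (by linarith), ← Real.rpow_natCast, ← Real.rpow_neg (by linarith), h2]
    congr 1
    field_simp
    ring
  have hpp : (0 : ℝ) < (p : ℝ) ^ p := by positivity
  set h : weightAlg p n := algebraMap ℚ_[p] _ (((p : ℚ_[p]) ^ p)⁻¹) * t p n ^ d with hh
  have hn : ‖h‖ ≤ 1 := by
    refine (TateDisk.norm_algebraMap_mul_coord_pow_le _ _).trans (le_of_eq ?_)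
    rw [hrad, norm_inv, norm_pow, Padic.norm_p, inv_pow, inv_inv, mul_inv_cancel₀ hpp.ne']
  have heh : ‖e h‖ = (p : ℝ) ^ p * ‖z‖ ^ d := by
    rw [hh, map_mul, map_pow, AlgHomClass.commutes, norm_mul, norm_pow, norm_algebraMap', norm_inv,
      norm_pow, Padic.norm_p, inv_pow, inv_inv]
  have heh1 : 1 < ‖e h‖ := by
    rw [heh, ← mul_inv_cancel₀ hpp.ne', ← hrad]
    have := pow_lt_pow_left₀ hlt (NNReal.coe_nonneg _) hd0
    gcongr
  obtain ⟨m, hm⟩ := pow_unbounded_of_one_lt (p : ℝ) heh1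
  set x : weightAlg p n := algebraMap ℚ_[p] _ (p : ℚ_[p]) * h ^ m with hx
  have hxn : ‖x‖ < 1 := by
    refine (norm_mul_le _ _).trans_lt ?_
    have h2 : ‖h ^ m‖ ≤ 1 := by
      rcases Nat.eq_zero_or_pos m with rfl | hm0
      · rw [pow_zero]; exact TateDisk.norm_one_le
      · exact (norm_pow_le' h hm0).trans (pow_le_one₀ (norm_nonneg _) hn)
    have h3 : ‖algebraMap ℚ_[p] (weightAlg p n) (p : ℚ_[p])‖ ≤ (p : ℝ)⁻¹ :=
      (TateDisk.norm_algebraMap_le _).trans (by rw [Padic.norm_p])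
    calc _ ≤ (p : ℝ)⁻¹ * 1 := mul_le_mul h3 h2 (norm_nonneg _) (by positivity)
      _ < 1 := by rw [mul_one]; exact inv_lt_one_of_one_lt₀ h1
  have hlim : Tendsto (fun k : ℕ ↦ x ^ k) atTop (𝓝 0) := by
    refine squeeze_zero_norm' ?_ (tendsto_pow_atTop_nhds_zero_of_lt_one (norm_nonneg x) hxn)
    filter_upwards [eventually_gt_atTop 0] with k hk
    exact norm_pow_le' x hk
  have hlim' : Tendsto (fun k : ℕ ↦ e x ^ k) atTop (𝓝 0) := by
    have := (e.cont.tendsto 0).comp hlim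
    rw [show e.toAlgHom.toFun 0 = 0 from map_zero e] at this
    exact this.congr fun k ↦ map_pow e x k
  rw [tendsto_pow_atTop_nhds_zero_iff_norm_lt_one, hx, map_mul, map_pow, AlgHomClass.commutes,
    norm_mul, norm_algebraMap', Padic.norm_p, norm_pow, inv_mul_lt_iff₀ (by linarith), mul_one]
    at hlim'
  exact lt_asymm hlim' hm

/-- A `p ^ n`-th root of an element close to `1` lies in the disc of radius `weightRadius p n`
around `1`. -/
theorem norm_sub_one_le_of_pow {L : Type*} [NormedField L] [NormedAlgebra ℚ_[p] L]
    [IsUltrametricDist L] {w : L} (hw : ‖w ^ (p ^ n) - 1‖ ≤ weightRadius p 0) :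
    ‖w - 1‖ ≤ weightRadius p n := by
  -- For `‖T‖ > weightRadius p n`, the term `T ^ q` would dominate in `(1 + T) ^ q - 1`.
  by_contra! hlt
  set q := p ^ n with hq
  set T := w - 1 with hT
  have hρ : (0 : ℝ) < weightRadius p n := by exact_mod_cast weightRadius_pos p n
  have hq0 : q ≠ 0 := pow_ne_zero _ hp.out.ne_zero
  have hr : 1 < ‖T‖ / weightRadius p n := (one_lt_div hρ).2 hlt
  set r := ‖T‖ / (weightRadius p n : ℝ) with hr_def
  have hTr : ‖T‖ = weightRadius p n * r := by rw [hr_def]; field_simp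
  have h1 : w ^ q - 1 = T ^ q + ∑ i ∈ Finset.Ico 1 q, T ^ i * (q.choose i : L) := by
    have h2 : w = T + 1 := by rw [hT, sub_add_cancel]
    rw [h2, add_pow, Finset.sum_range_succ,
      ← Finset.sum_range_add_sum_Ico _ (Nat.one_le_iff_ne_zero.2 hq0)]
    simp only [one_pow, mul_one, Finset.sum_range_one, pow_zero, Nat.choose_zero_right,
      Nat.cast_one, Nat.choose_self]
    ring
  have h3 : ‖∑ i ∈ Finset.Ico 1 q, T ^ i * (q.choose i : L)‖ ≤ weightRadius p 0 * r ^ (q - 1) := by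
    refine IsUltrametricDist.norm_sum_le_of_forall_le_of_nonneg (by positivity) fun i hi ↦ ?_
    rw [Finset.mem_Ico] at hi
    have h4 := norm_choose_mul_weightRadius_pow_le p n (i := i) (by omega)
    have h5 : ‖(q.choose i : L)‖ = ‖(q.choose i : ℚ_[p])‖ := by
      have := norm_algebraMap' L (q.choose i : ℚ_[p])
      rwa [map_natCast] at this
    rw [norm_mul, norm_pow, h5, hTr, mul_pow]
    calc _ = (‖(q.choose i : ℚ_[p])‖ * (weightRadius p n : ℝ) ^ i) * r ^ i := by ring
      _ ≤ weightRadius p 0 * r ^ (q - 1) := by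
        refine mul_le_mul h4 (pow_le_pow_right₀ hr.le (by omega)) (by positivity) (by positivity)
  have hρ0 : (0 : ℝ) < weightRadius p 0 := by exact_mod_cast weightRadius_pos p 0
  have h6 : ‖T ^ q‖ = weightRadius p 0 * r ^ q := by
    rw [norm_pow, hTr, mul_pow, weightRadius_pow]
  have h7 : ‖T ^ q‖ ≤ weightRadius p 0 * r ^ (q - 1) := by
    have : T ^ q = (w ^ q - 1) - ∑ i ∈ Finset.Ico 1 q, T ^ i * (q.choose i : L) := by
      rw [h1]; ring
    rw [this]
    exact IsUltrametricDist.norm_sub_le_of_le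
      (hw.trans (le_mul_of_one_le_right hρ0.le (one_le_pow₀ hr.le))) h3
  rw [h6] at h7
  have h8 : r ^ (q - 1) < r ^ q := pow_lt_pow_right₀ hr (by omega)
  exact absurd h7 (not_le.2 (mul_lt_mul_of_pos_left h8 hρ0))

end WeightSpace

/-! ### Finiteness of the weight algebra over the algebra of the ball -/

namespace WeightSpace

variable {p : ℕ} [hp : Fact p.Prime] {n : ℕ}

/-- Expansion of `t ^ k` in the basis `1, t, …, t ^ (p ^ n - 1)` over `B`, with bounded coefficients:
the monic polynomial `(1 + t) ^ (p ^ n) - 1` is the pullback of `exp (p ^ n g s) - 1`, whence a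
recursion for `t ^ k` in which every term is as small as required. -/
theorem exists_t_pow_eq_sum {g : ℚ_[p]} (hg : ‖g‖ = (p : ℝ)⁻¹) (hg0 : g ≠ 0) (k : ℕ) :
    ∃ b : ℕ → ballAlg p n, (∀ i < p ^ n, ‖b i‖ * (weightRadius p n : ℝ) ^ i ≤
        (weightRadius p n : ℝ) ^ k) ∧
      t p n ^ k = ∑ i ∈ Finset.range (p ^ n), thetaPullback n hg (b i) * t p n ^ i := by
  induction k using Nat.strong_induction_on with
  | _ k ih =>
  have hφK (a : ℚ_[p]) : thetaPullback n hg (algebraMap ℚ_[p] _ a) = algebraMap ℚ_[p] _ a :=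
    AlgHomClass.commutes _ a
  have hρ : (0 : ℝ) < weightRadius p n := by exact_mod_cast weightRadius_pos p n
  have hq0 : 1 ≤ p ^ n := Nat.one_le_pow _ _ hp.out.pos
  have hE := thetaPullback_expFun (n := n) hg hg0
  have hC (j : ℕ) (hj : j ≠ 0) := norm_choose_mul_weightRadius_pow_le p n hj
  have hρq := weightRadius_pow p n
  set q := p ^ n with hq
  rcases lt_or_ge k q with hk | hk
  · refine ⟨Pi.single k 1, fun i _ ↦ ?_, ?_⟩
    · rcases eq_or_ne i k with rfl | hik
      · rw [Pi.single_eq_same]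
        exact mul_le_of_le_one_left (by positivity) TateDisk.norm_one_le
      · rw [Pi.single_eq_of_ne hik, norm_zero, zero_mul]
        positivity
    · rw [Finset.sum_eq_single k]
      · rw [Pi.single_eq_same, map_one, one_mul]
      · intro i _ hik
        rw [Pi.single_eq_of_ne hik, map_zero, zero_mul]
      · intro h
        exact absurd (Finset.mem_range.2 hk) h
  · choose! β hβ1 hβ2 using ih
    have h1 : t p n ^ k = (thetaPullback n hg (expFun n hg) - 1) * t p n ^ (k - q) -
        ∑ j ∈ Finset.Ico 1 q, algebraMap ℚ_[p] _ (q.choose j : ℚ_[p]) * t p n ^ (k - q + j) := by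
      have h2 : (1 + t p n) ^ q - 1 = t p n ^ q + ∑ j ∈ Finset.Ico 1 q,
          algebraMap ℚ_[p] _ (q.choose j : ℚ_[p]) * t p n ^ j := by
        rw [add_comm, add_pow, Finset.sum_range_succ, ← Finset.sum_range_add_sum_Ico _ hq0]
        have h3 : ∑ j ∈ Finset.Ico 1 q, algebraMap ℚ_[p] _ (q.choose j : ℚ_[p]) * t p n ^ j =
            ∑ j ∈ Finset.Ico 1 q, t p n ^ j * (q.choose j : weightAlg p n) :=
          Finset.sum_congr rfl fun j _ ↦ by rw [map_natCast, mul_comm]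
        rw [h3]
        simp only [one_pow, mul_one, Finset.sum_range_one, pow_zero, Nat.choose_zero_right,
          Nat.cast_one, Nat.choose_self]
        ring
      rw [hE, h2, add_mul, ← pow_add, Finset.sum_mul, Nat.add_sub_cancel' hk, eq_sub_iff_add_eq]
      congr 1
      refine Finset.sum_congr rfl fun j _ ↦ ?_
      rw [pow_add]; ring
    -- The recursion `t ^ k = φ (exp (p ^ n g s) - 1) t ^ (k - q) - ∑ C(q, j) t ^ (k - q + j)`.
    refine ⟨fun i ↦ (expFun n hg - 1) * β (k - q) i - ∑ j ∈ Finset.Ico 1 q,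
      algebraMap ℚ_[p] _ (q.choose j : ℚ_[p]) * β (k - q + j) i, fun i hi ↦ ?_, ?_⟩
    · rw [← le_div_iff₀ (by positivity)]
      refine IsUltrametricDist.norm_sub_le_of_le ?_ ?_
      · refine (norm_mul_le _ _).trans ?_
        rw [le_div_iff₀ (by positivity), mul_assoc]
        calc _ ≤ (weightRadius p 0 : ℝ) * (weightRadius p n : ℝ) ^ (k - q) :=
              mul_le_mul (norm_expFun_sub_one_le hg) (hβ1 _ (by omega) i hi) (by positivity)
                (by positivity)
          _ = (weightRadius p n : ℝ) ^ k := by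
            rw [← hρq, ← pow_add, Nat.add_sub_cancel' hk]
      · refine IsUltrametricDist.norm_sum_le_of_forall_le_of_nonneg (by positivity) fun j hj ↦ ?_
        rw [Finset.mem_Ico] at hj
        rw [le_div_iff₀ (by positivity)]
        calc _ ≤ ‖(q.choose j : ℚ_[p])‖ * ‖β (k - q + j) i‖ * (weightRadius p n : ℝ) ^ i := by
              gcongr
              exact (norm_mul_le _ _).trans (by gcongr; exact TateDisk.norm_algebraMap_le _)
          _ ≤ ‖(q.choose j : ℚ_[p])‖ * (weightRadius p n : ℝ) ^ (k - q + j) := by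
              rw [mul_assoc]
              gcongr
              exact hβ1 _ (by omega) i hi
          _ = (‖(q.choose j : ℚ_[p])‖ * (weightRadius p n : ℝ) ^ j) *
              (weightRadius p n : ℝ) ^ (k - q) := by ring
          _ ≤ (weightRadius p 0 : ℝ) * (weightRadius p n : ℝ) ^ (k - q) := by
              gcongr
              exact hC j (by omega)
          _ = (weightRadius p n : ℝ) ^ k := by
            rw [← hρq, ← pow_add, Nat.add_sub_cancel' hk]
    · have h3 : ∑ j ∈ Finset.Ico 1 q,
          algebraMap ℚ_[p] _ (q.choose j : ℚ_[p]) * t p n ^ (k - q + j) =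
          ∑ j ∈ Finset.Ico 1 q, algebraMap ℚ_[p] _ (q.choose j : ℚ_[p]) *
            ∑ i ∈ Finset.range q, thetaPullback n hg (β (k - q + j) i) * t p n ^ i := by
        refine Finset.sum_congr rfl fun j hj ↦ ?_
        rw [Finset.mem_Ico] at hj
        rw [← hβ2 (k - q + j) (by omega)]
      rw [h1, h3, hβ2 (k - q) (by omega), Finset.mul_sum]
      simp only [Finset.mul_sum]
      rw [Finset.sum_comm, ← Finset.sum_sub_distrib]
      refine Finset.sum_congr rfl fun i _ ↦ ?_
      simp only [map_sub, map_mul, map_sum, map_one, hφK, sub_mul, Finset.sum_mul, mul_assoc]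

/-- `A` is generated by `1, t, …, t ^ (p ^ n - 1)` as a `B`-module: the expansions of the powers of
`t` can be summed because their coefficients are bounded. -/
theorem exists_eq_sum_thetaPullback {g : ℚ_[p]} (hg : ‖g‖ = (p : ℝ)⁻¹) (hg0 : g ≠ 0)
    (f : weightAlg p n) : ∃ b : ℕ → ballAlg p n,
      f = ∑ i ∈ Finset.range (p ^ n), thetaPullback n hg (b i) * t p n ^ i := by
  have hρ : (0 : ℝ) < weightRadius p n := by exact_mod_cast weightRadius_pos p n
  choose β hβ1 hβ2 using exists_t_pow_eq_sum (n := n) hg hg0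
  have hsum (i : ℕ) (hi : i < p ^ n) :
      Summable fun k ↦ algebraMap ℚ_[p] (ballAlg p n) (TateDisk.coeff k f) * β k i := by
    refine IsUltrametricDist.summable_of_tendsto_zero ?_
    have h1 := f.tendsto_coeff.mul_const ((weightRadius p n : ℝ) ^ i)⁻¹
    rw [zero_mul] at h1
    refine squeeze_zero_norm (fun k ↦ ?_) h1
    refine (norm_mul_le _ _).trans ?_
    rw [mul_assoc]
    refine mul_le_mul (TateDisk.norm_algebraMap_le _) ?_ (norm_nonneg _) (norm_nonneg _)
    rw [← div_eq_mul_inv, le_div_iff₀ (by positivity)]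
    exact hβ1 k i hi
  refine ⟨fun i ↦ ∑' k, algebraMap ℚ_[p] (ballAlg p n) (TateDisk.coeff k f) * β k i, ?_⟩
  have h2 : HasSum (fun k ↦ ∑ i ∈ Finset.range (p ^ n), thetaPullback n hg
      (algebraMap ℚ_[p] (ballAlg p n) (TateDisk.coeff k f) * β k i) * t p n ^ i)
      (∑ i ∈ Finset.range (p ^ n), thetaPullback n hg
        (∑' k, algebraMap ℚ_[p] (ballAlg p n) (TateDisk.coeff k f) * β k i) * t p n ^ i) := by
    refine hasSum_sum fun i hi ↦ ?_
    exact ((hsum i (Finset.mem_range.1 hi)).hasSum.map (thetaPullback n hg)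
      (thetaPullback n hg).cont).mul_right (t p n ^ i)
  have h3 (k : ℕ) : ∑ i ∈ Finset.range (p ^ n), thetaPullback n hg
      (algebraMap ℚ_[p] (ballAlg p n) (TateDisk.coeff k f) * β k i) * t p n ^ i =
      algebraMap ℚ_[p] (weightAlg p n) (TateDisk.coeff k f) * t p n ^ k := by
    rw [hβ2 k, Finset.mul_sum]
    refine Finset.sum_congr rfl fun i _ ↦ ?_
    rw [map_mul, AlgHomClass.commutes, mul_assoc]
  simp only [h3] at h2
  exact f.hasSum.unique h2

/-- Surjectivity of `ϑ` on maximal ideals: `A` is a finite, hence integral, extension of `B`. -/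
theorem exists_isMaximal_comap_eq {g : ℚ_[p]} (hg : ‖g‖ = (p : ℝ)⁻¹) (hg0 : g ≠ 0)
    (m : Ideal (ballAlg p n)) (hm : m.IsMaximal) :
    ∃ m' : Ideal (weightAlg p n), m'.IsMaximal ∧
      m'.comap (thetaPullback n hg : ballAlg p n →ₐ[ℚ_[p]] weightAlg p n) = m := by
  let φ : ballAlg p n →+* weightAlg p n :=
    ((thetaPullback n hg : ballAlg p n →ₐ[ℚ_[p]] weightAlg p n) : ballAlg p n →+* weightAlg p n)
  let : Algebra (ballAlg p n) (weightAlg p n) := φ.toAlgebra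
  have hfin : Module.Finite (ballAlg p n) (weightAlg p n) := by
    refine Module.Finite.of_surjective
      (Fintype.linearCombination (ballAlg p n) fun i : Fin (p ^ n) ↦ t p n ^ (i : ℕ)) fun f ↦ ?_
    obtain ⟨b, hb⟩ := exists_eq_sum_thetaPullback hg hg0 f
    refine ⟨fun i ↦ b i, ?_⟩
    rw [Fintype.linearCombination_apply, hb, Finset.sum_range]
    rfl
  have : Algebra.IsIntegral (ballAlg p n) (weightAlg p n) := .of_finite _ _
  refine Ideal.exists_ideal_over_maximal_of_isIntegral (S := weightAlg p n) m ?_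
  change RingHom.ker φ ≤ m
  rw [(RingHom.injective_iff_ker_eq_bot φ).1 (thetaPullback_injective hg)]
  exact bot_le

/-! ### The action of the torsion subgroup -/

theorem norm_one_torsionAlg_le : ‖(1 : torsionAlg p n)‖ ≤ 1 := by
  rw [← map_one (Ideal.Quotient.mk (torsionIdeal p n))]
  exact (Ideal.Quotient.norm_mk_le _ _).trans TateDisk.norm_one_le

/-- The algebra of `𝒲⁰_n[p ^ n] × 𝒲⁰_n`. -/
abbrev actionAlg (p : ℕ) [Fact p.Prime] (n : ℕ) : Type :=
  CompletedTensor ℚ_[p] (torsionAlg p n) (weightAlg p n)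

theorem norm_algebraMap_actionAlg_le (a : ℚ_[p]) : ‖algebraMap ℚ_[p] (actionAlg p n) a‖ ≤ ‖a‖ := by
  rw [CompletedTensor.algebraMap_eq_inclRight]
  exact (CompletedTensor.norm_inclRight_le norm_one_torsionAlg_le _).trans
    (TateDisk.norm_algebraMap_le a)

/-- The coordinate of the first factor of `𝒲⁰_n[p ^ n] × 𝒲⁰_n`. -/
def tLeft (p : ℕ) [Fact p.Prime] (n : ℕ) : actionAlg p n :=
  CompletedTensor.inclLeft ℚ_[p] (torsionAlg p n) (weightAlg p n)
    (Ideal.Quotient.mk (torsionIdeal p n) (t p n))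

/-- The coordinate of the second factor of `𝒲⁰_n[p ^ n] × 𝒲⁰_n`. -/
def tRight (p : ℕ) [Fact p.Prime] (n : ℕ) : actionAlg p n :=
  CompletedTensor.inclRight ℚ_[p] (torsionAlg p n) (weightAlg p n) (t p n)

theorem norm_tLeft_le : ‖tLeft p n‖ ≤ weightRadius p n :=
  (CompletedTensor.norm_inclLeft_le TateDisk.norm_one_le _).trans
    ((Ideal.Quotient.norm_mk_le _ _).trans TateDisk.norm_coord_le)

theorem norm_tRight_le : ‖tRight p n‖ ≤ weightRadius p n :=
  (CompletedTensor.norm_inclRight_le norm_one_torsionAlg_le _).trans TateDisk.norm_coord_le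

theorem norm_tRight_add_tLeft_add_mul_le :
    ‖tRight p n + tLeft p n + tLeft p n * tRight p n‖ ≤ weightRadius p n := by
  refine (IsUltrametricDist.norm_add_le_max _ _).trans (max_le
    ((IsUltrametricDist.norm_add_le_max _ _).trans (max_le norm_tRight_le norm_tLeft_le)) ?_)
  refine (norm_mul_le _ _).trans ?_
  calc _ ≤ 1 * (weightRadius p n : ℝ) :=
        mul_le_mul (norm_tLeft_le.trans (weightRadius_lt_one p n).le) norm_tRight_le
          (norm_nonneg _) zero_le_one
    _ = _ := one_mul _

theorem one_add_tLeft_pow : (1 + tLeft p n) ^ (p ^ n) = 1 := by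
  have h1 : Ideal.Quotient.mk (torsionIdeal p n) ((1 + t p n) ^ (p ^ n) - 1) = 0 :=
    Ideal.Quotient.eq_zero_iff_mem.2 (Ideal.subset_span rfl)
  have h2 := congrArg (CompletedTensor.inclLeft ℚ_[p] (torsionAlg p n) (weightAlg p n)) h1
  simp only [map_sub, map_pow, map_add, map_one, map_zero] at h2
  exact sub_eq_zero.1 h2

/-- The pullback along the multiplication `𝒲⁰_n[p ^ n] × 𝒲⁰_n → 𝒲⁰_n`. -/
def actPullback (p : ℕ) [Fact p.Prime] (n : ℕ) : weightAlg p n →A[ℚ_[p]] actionAlg p n :=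
  TateDisk.evalAlgHom norm_algebraMap_actionAlg_le
    (tRight p n + tLeft p n + tLeft p n * tRight p n) norm_tRight_add_tLeft_add_mul_le

theorem actPullback_t :
    actPullback p n (t p n) = tRight p n + tLeft p n + tLeft p n * tRight p n :=
  TateDisk.evalAlgHom_coord _ _

theorem actPullback_one_add_t :
    actPullback p n (1 + t p n) = (1 + tLeft p n) * (1 + tRight p n) := by
  rw [map_add, map_one, actPullback_t]
  ring

/-- Translation by a torsion point does not change `ϑ`: it does not change `(1 + t) ^ (p ^ n)`, the
pullback of `exp (p ^ n g s)`, which determines `s`. -/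
theorem actPullback_thetaPullback {g : ℚ_[p]} (hg : ‖g‖ = (p : ℝ)⁻¹) (hg0 : g ≠ 0)
    (b : ballAlg p n) : actPullback p n (thetaPullback n hg b) =
      CompletedTensor.inclRight ℚ_[p] (torsionAlg p n) (weightAlg p n) (thetaPullback n hg b) := by
  let φ : ballAlg p n →+* weightAlg p n :=
    ((thetaPullback n hg : ballAlg p n →ₐ[ℚ_[p]] weightAlg p n) : ballAlg p n →+* weightAlg p n)
  let μ : weightAlg p n →+* actionAlg p n :=
    ((actPullback p n : weightAlg p n →ₐ[ℚ_[p]] actionAlg p n) : weightAlg p n →+* actionAlg p n)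
  let ι := CompletedTensor.inclRight ℚ_[p] (torsionAlg p n) (weightAlg p n)
  have hι : Continuous ι := AddMonoidHom.continuous_of_norm_le ι
    (CompletedTensor.norm_inclRight_le norm_one_torsionAlg_le)
  have hφ : Continuous φ := (thetaPullback n hg).cont
  have hμ : Continuous μ := (actPullback p n).cont
  have hE : φ (expFun n hg) = (1 + t p n) ^ (p ^ n) := thetaPullback_expFun hg hg0
  have hφK (a : ℚ_[p]) : φ (algebraMap ℚ_[p] _ a) = algebraMap ℚ_[p] _ a :=
    AlgHomClass.commutes (thetaPullback n hg) a
  have h1 : μ.comp φ = ι.comp φ := by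
    refine ballAlg_ringHom_ext hg hg0 (hμ.comp hφ) (hι.comp hφ) (fun a ↦ ?_) ?_
    · rw [RingHom.comp_apply, RingHom.comp_apply, hφK]
      exact (AlgHomClass.commutes (actPullback p n) a).trans
        (CompletedTensor.algebraMap_eq_inclRight a)
    · rw [RingHom.comp_apply, RingHom.comp_apply, hE, map_pow, map_pow]
      have h2 : μ (1 + t p n) = (1 + tLeft p n) * (1 + tRight p n) := actPullback_one_add_t
      have h3 : ι (1 + t p n) = 1 + tRight p n := by rw [map_add, map_one]; rfl
      rw [h2, h3, mul_pow, one_add_tLeft_pow, one_mul]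
  exact DFunLike.congr_fun h1 b

/-- The function `(1 + t)⁻¹` on `𝒲⁰_n` is given by the derivative of the logarithm. -/
theorem exists_one_add_t_mul_eq_one (p : ℕ) [hp : Fact p.Prime] (n : ℕ) :
    ∃ v : weightAlg p n, (1 + t p n) * v = 1 ∧ ‖v‖ ≤ 1 := by
  have hcoeff (k : ℕ) : ‖PowerSeries.coeff k (PowerSeries.derivative ℚ_[p]
      (PowerSeries.log ℚ_[p]))‖ * (weightRadius p n : ℝ) ^ k = (weightRadius p n : ℝ) ^ k := by
    rw [PowerSeries.deriv_log, PowerSeries.coeff_mk]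
    simp
  refine ⟨TateDisk.mk (PowerSeries.derivative ℚ_[p] (PowerSeries.log ℚ_[p])) ?_, ?_, ?_⟩
  · simp only [hcoeff]
    exact tendsto_pow_atTop_nhds_zero_of_lt_one (NNReal.coe_nonneg _) (weightRadius_lt_one p n)
  · exact TateDisk.ext PowerSeries.one_add_X_mul_deriv_log
  · refine TateDisk.norm_le fun k ↦ ?_
    rw [TateDisk.coeff_def, TateDisk.toPowerSeries_mk, hcoeff]
    exact pow_le_one₀ (NNReal.coe_nonneg _) (weightRadius_lt_one p n).le

/-- The isomorphism `𝒲⁰_n[p ^ n] × 𝒲⁰_n ≅ 𝒲⁰_n ×_X 𝒲⁰_n` over the ball `X`, whose inverse sends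
`(x, y)` to `(x y⁻¹, y)`: the quotient `x y⁻¹` is a `p ^ n`-torsion point because
`(1 + t) ^ (p ^ n)` is pulled back from `X`. -/
theorem exists_ringEquiv_actionAlg {g : ℚ_[p]} (hg : ‖g‖ = (p : ℝ)⁻¹) (hg0 : g ≠ 0) :
    letI : Algebra (ballAlg p n) (weightAlg p n) :=
      ((thetaPullback n hg : ballAlg p n →ₐ[ℚ_[p]] weightAlg p n) :
        ballAlg p n →+* weightAlg p n).toAlgebra
    ∃ Φ : CompletedTensor (ballAlg p n) (weightAlg p n) (weightAlg p n) ≃+* actionAlg p n,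
      Continuous Φ ∧ Continuous Φ.symm ∧
      (∀ a, Φ (CompletedTensor.inclLeft (ballAlg p n) (weightAlg p n) (weightAlg p n) a) =
        actPullback p n a) ∧
      (∀ a, Φ (CompletedTensor.inclRight (ballAlg p n) (weightAlg p n) (weightAlg p n) a) =
        CompletedTensor.inclRight ℚ_[p] (torsionAlg p n) (weightAlg p n) a) := by
  let φ : ballAlg p n →+* weightAlg p n :=
    ((thetaPullback n hg : ballAlg p n →ₐ[ℚ_[p]] weightAlg p n) : ballAlg p n →+* weightAlg p n)
  let : Algebra (ballAlg p n) (weightAlg p n) := φ.toAlgebra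
  have hφK (a : ℚ_[p]) : φ (algebraMap ℚ_[p] _ a) = algebraMap ℚ_[p] _ a :=
    AlgHomClass.commutes (thetaPullback n hg) a
  have hE : φ (expFun n hg) = (1 + t p n) ^ (p ^ n) := thetaPullback_expFun hg hg0
  let μ : weightAlg p n →+* actionAlg p n :=
    ((actPullback p n : weightAlg p n →ₐ[ℚ_[p]] actionAlg p n) : weightAlg p n →+* actionAlg p n)
  have hμ : Continuous μ := (actPullback p n).cont
  have hμ1 : μ (1 + t p n) = (1 + tLeft p n) * (1 + tRight p n) := actPullback_one_add_t
  have hμK (a : ℚ_[p]) : μ (algebraMap ℚ_[p] _ a) = algebraMap ℚ_[p] _ a :=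
    AlgHomClass.commutes (actPullback p n) a
  let ιl := CompletedTensor.inclLeft ℚ_[p] (torsionAlg p n) (weightAlg p n)
  let ιr := CompletedTensor.inclRight ℚ_[p] (torsionAlg p n) (weightAlg p n)
  have hιr : ιr (1 + t p n) = 1 + tRight p n := by rw [map_add, map_one]; rfl
  let jl := CompletedTensor.inclLeft (ballAlg p n) (weightAlg p n) (weightAlg p n)
  let jr := CompletedTensor.inclRight (ballAlg p n) (weightAlg p n) (weightAlg p n)
  have hjl (x) : ‖jl x‖ ≤ ‖x‖ := CompletedTensor.norm_inclLeft_le TateDisk.norm_one_le x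
  have hjr (x) : ‖jr x‖ ≤ ‖x‖ := CompletedTensor.norm_inclRight_le TateDisk.norm_one_le x
  have hj (b : ballAlg p n) : jl (φ b) = jr (φ b) := CompletedTensor.inclLeft_algebraMap b
  -- the function `x y⁻¹ - 1` on the fibre product
  obtain ⟨v, hv1, hv2⟩ := exists_one_add_t_mul_eq_one p n
  set τ := jl (1 + t p n) * jr v - 1 with hτ_def
  have hτ1 : 1 + τ = jl (1 + t p n) * jr v := by rw [hτ_def]; ring
  have hτ : ‖τ‖ ≤ weightRadius p n := by
    have h1 : τ = (jl (t p n) - jr (t p n)) * jr v := by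
      have h2 : jr ((1 + t p n) * v) = 1 := by rw [hv1, map_one]
      rw [map_mul, map_add, map_one] at h2
      rw [hτ_def, map_add, map_one]
      linear_combination h2
    rw [h1]
    refine (norm_mul_le _ _).trans ?_
    refine (mul_le_of_le_one_right (norm_nonneg _) ((hjr v).trans hv2)).trans ?_
    exact IsUltrametricDist.norm_sub_le_of_le ((hjl _).trans TateDisk.norm_coord_le)
      ((hjr _).trans TateDisk.norm_coord_le)
  have hτq : (1 + τ) ^ (p ^ n) = 1 := by
    rw [hτ1, mul_pow, ← map_pow, ← hE, hj, hE, ← map_pow, ← map_mul, ← mul_pow, hv1, one_pow,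
      map_one]
  let i : ℚ_[p] →+* CompletedTensor (ballAlg p n) (weightAlg p n) (weightAlg p n) :=
    jr.comp (algebraMap ℚ_[p] (weightAlg p n))
  have hi (a : ℚ_[p]) : ‖i a‖ ≤ ‖a‖ := (hjr _).trans (TateDisk.norm_algebraMap_le a)
  -- the pullback along `(x, y) ↦ x y⁻¹`, which factors through the torsion subgroup
  let δ := TateDisk.evalHom i hi τ hτ
  have hδt : δ (1 + t p n) = 1 + τ := by
    rw [map_add, map_one]
    exact congrArg (1 + ·) (TateDisk.evalHom_coord hi hτ)
  have hδK (a : ℚ_[p]) : δ (algebraMap ℚ_[p] _ a) = i a := TateDisk.evalHom_algebraMap hi hτ a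
  have hδc : Continuous δ := TateDisk.continuous_evalHom hi hτ
  have hδ (a) (ha : a ∈ torsionIdeal p n) : δ a = 0 := by
    have h1 : torsionIdeal p n ≤ RingHom.ker δ := by
      rw [torsionIdeal, Ideal.span_singleton_le_iff_mem, RingHom.mem_ker, map_sub, map_pow, hδt,
        hτq, map_one, sub_self]
    exact h1 ha
  let δ' : torsionAlg p n →+* _ := Ideal.Quotient.lift (torsionIdeal p n) δ hδ
  have hδ' (a) : δ' (Ideal.Quotient.mk (torsionIdeal p n) a) = δ a := Ideal.Quotient.lift_mk ..
  obtain ⟨Ψ, hΨ, hΨl, hΨr⟩ := CompletedTensor.exists_lift (R := ℚ_[p]) δ' jr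
    (fun a ↦ (hδ' (algebraMap ℚ_[p] _ a)).trans (hδK a))
    (Ideal.Quotient.norm_lift_le _ _ _ (TateDisk.norm_evalHom_le hi hτ)) hjr
  obtain ⟨Φ, hΦ, hΦl, hΦr⟩ := CompletedTensor.exists_lift (R := ballAlg p n) μ ιr
    (fun b ↦ actPullback_thetaPullback hg hg0 b)
    (TateDisk.norm_evalAlgHom_le norm_algebraMap_actionAlg_le norm_tRight_add_tLeft_add_mul_le)
    (CompletedTensor.norm_inclRight_le norm_one_torsionAlg_le)
  change ∀ x, Ψ (ιl x) = δ' x at hΨl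
  change ∀ x, Ψ (ιr x) = jr x at hΨr
  change ∀ x, Φ (jl x) = μ x at hΦl
  change ∀ x, Φ (jr x) = ιr x at hΦr
  have hιlc : Continuous ιl := AddMonoidHom.continuous_of_norm_le ιl
    (CompletedTensor.norm_inclLeft_le TateDisk.norm_one_le)
  have hjlc : Continuous jl := AddMonoidHom.continuous_of_norm_le jl hjl
  have hmkc : Continuous (Ideal.Quotient.mk (torsionIdeal p n)) :=
    AddMonoidHom.continuous_of_norm_le _ (Ideal.Quotient.norm_mk_le _)
  have hvr : ιr (1 + t p n) * ιr v = 1 := by rw [← map_mul, hv1, map_one]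
  have hvj : jr v * jr (1 + t p n) = 1 := by rw [← map_mul, mul_comm, hv1, map_one]
  -- Both composites are checked on coordinates.
  have hΦΨ : Φ.comp Ψ = RingHom.id _ := by
    refine CompletedTensor.ringHom_ext (hΦ.comp hΨ) continuous_id (fun x ↦ ?_) fun y ↦ ?_
    · obtain ⟨a, rfl⟩ := Ideal.Quotient.mk_surjective x
      have h1 : (Φ.comp δ) = ιl.comp (Ideal.Quotient.mk (torsionIdeal p n)) := by
        refine TateDisk.ringHom_ext (hΦ.comp hδc) (hιlc.comp hmkc) (fun a ↦ ?_) ?_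
        · rw [RingHom.comp_apply, hδK]
          exact (hΦr _).trans (CompletedTensor.inclLeft_algebraMap a).symm
        · have h2 : Φ (1 + τ) = 1 + tLeft p n := by
            rw [hτ1, map_mul, hΦl, hΦr, hμ1, ← hιr, mul_assoc, hvr, mul_one]
          rw [map_add, map_one, add_right_inj] at h2
          have h3 : δ (TateDisk.coord _ _) = τ := TateDisk.evalHom_coord hi hτ
          rw [RingHom.comp_apply, h3, h2]
          rfl
      change Φ (Ψ (ιl _)) = ιl _
      rw [hΨl, hδ']
      exact DFunLike.congr_fun h1 a
    · change Φ (Ψ (ιr y)) = ιr y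
      rw [hΨr, hΦr]
  have hΨΦ : Ψ.comp Φ = RingHom.id _ := by
    refine CompletedTensor.ringHom_ext (hΨ.comp hΦ) continuous_id (fun x ↦ ?_) fun y ↦ ?_
    · have h1 : Ψ.comp μ = jl := by
        refine TateDisk.ringHom_ext (hΨ.comp hμ) hjlc (fun a ↦ ?_) ?_
        · rw [RingHom.comp_apply, hμK, CompletedTensor.algebraMap_eq_inclRight, ← hφK a, hj]
          exact hΨr _
        · have h2 : Ψ (1 + tLeft p n) = 1 + τ := by
            rw [map_add, map_one]
            refine congrArg (1 + ·) ((hΨl _).trans ((hδ' _).trans ?_))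
            exact TateDisk.evalHom_coord hi hτ
          have h3 : Ψ (μ (1 + t p n)) = jl (1 + t p n) := by
            rw [hμ1, ← hιr, map_mul, hΨr, h2, hτ1, mul_assoc, hvj, mul_one]
          rw [map_add, map_add, map_add, map_one, map_one, map_one, add_right_inj] at h3
          exact h3
      change Ψ (Φ (jl x)) = jl x
      rw [hΦl]
      exact DFunLike.congr_fun h1 x
    · change Ψ (Φ (jr y)) = jr y
      rw [hΦr, hΨr]
  exact ⟨RingEquiv.ofRingHom Φ Ψ hΦΨ hΨΦ, hΦ, hΨ, hΦl, hΦr⟩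

theorem isAffinoidQuotient_thetaPullback {g : ℚ_[p]} (hg : ‖g‖ = (p : ℝ)⁻¹) (hg0 : g ≠ 0) :
    IsAffinoidQuotient (thetaPullback n hg) (actPullback p n) where
  surjective := exists_isMaximal_comap_eq hg hg0
  coincide := actPullback_thetaPullback hg hg0
  isomorphism := exists_ringEquiv_actionAlg hg hg0

/-! ### The bijection with characters -/

variable {γ : ℤ_[p]ˣ} {L : Type*} [NormedField L] [NormedAlgebra ℚ_[p] L] [CompleteSpace L]

/-- Every `x` in the ball of the algebraically closed field `L` is a value of `ϑ`: a `p ^ n`-th root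
of `exp (p ^ n x log γ)` is the value at `γ` of a suitable character. -/
theorem exists_theta_eq [IsAlgClosed L] (hγ : IsTopologicalGenerator p γ)
    (hg : ‖logGen γ‖ = (p : ℝ)⁻¹) (hg0 : logGen γ ≠ 0) {x : L} (hx : ‖x‖ ≤ ballRadius p n) :
    ∃ ψ ∈ points γ n L, theta γ ψ = x := by
  have : IsUltrametricDist L := IsUltrametricDist.of_normedAlgebra ℚ_[p]
  have hi (a : ℚ_[p]) : ‖algebraMap ℚ_[p] L a‖ ≤ ‖a‖ := (norm_algebraMap' L a).le
  let ex : ballAlg p n →A[ℚ_[p]] L := TateDisk.evalAlgHom hi x hx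
  obtain ⟨w, hw⟩ := IsAlgClosed.exists_pow_nat_eq (ex (expFun n hg)) (n := p ^ n)
    (pow_pos hp.out.pos n)
  have hw1 : ‖w ^ (p ^ n) - 1‖ ≤ weightRadius p 0 := by
    rw [hw, ← map_one ex, ← map_sub]
    exact (TateDisk.norm_evalAlgHom_le hi hx _).trans (norm_expFun_sub_one_le hg)
  have hw2 := norm_sub_one_le_of_pow hw1
  obtain ⟨ψ, hψ1, hψ2⟩ := hγ.exists_character (hw2.trans_lt (weightRadius_lt_one p n))
  have hz : ((ψ γ : Lˣ) : L) - 1 = w - 1 := by rw [hψ2, add_sub_cancel_left]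
  refine ⟨ψ, ⟨hψ1, by rwa [hz]⟩, ?_⟩
  let e : weightAlg p n →A[ℚ_[p]] L := TateDisk.evalAlgHom hi (w - 1) hw2
  have het : e (t p n) = w - 1 := TateDisk.evalAlgHom_coord hi hw2
  have h1 : (((e.comp (thetaPullback n hg)) : ballAlg p n →ₐ[ℚ_[p]] L) : ballAlg p n →+* L) =
      ((ex : ballAlg p n →ₐ[ℚ_[p]] L) : ballAlg p n →+* L) := by
    refine ballAlg_ringHom_ext hg hg0 (e.comp (thetaPullback n hg)).cont ex.cont (fun a ↦ ?_) ?_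
    · exact (AlgHomClass.commutes (e.comp (thetaPullback n hg)) a).trans
        (AlgHomClass.commutes ex a).symm
    · change e (thetaPullback n hg (expFun n hg)) = ex (expFun n hg)
      rw [thetaPullback_expFun hg hg0, map_pow, map_add, map_one, het, add_sub_cancel, hw]
  have h2 : e (thetaPullback n hg (s p n)) = ex (s p n) := DFunLike.congr_fun h1 (s p n)
  rw [thetaPullback_s] at h2
  rw [theta, hz, ← evalAlgHom_thetaFun hi hw2]
  exact h2.trans (TateDisk.evalAlgHom_coord hi hx)

/-- Characters in `𝒲⁰_n(L)` correspond to `L`-valued points of `A` by evaluation of functions at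
`t = ψ(γ) - 1`. -/
theorem exists_pointsEquiv (hγ : IsTopologicalGenerator p γ) (n : ℕ) :
    ∃ E : points γ n L ≃ (weightAlg p n →A[ℚ_[p]] L), ∀ ψ : points γ n L,
      E ψ (t p n) = ((ψ.1 γ : Lˣ) : L) - 1 ∧
      E ψ (thetaFun n (logGen γ)) = theta γ ψ.1 ∧
      (∀ f, ‖E ψ f‖ ≤ ‖f‖) ∧
      ((∀ f ∈ torsionIdeal p n, E ψ f = 0) ↔ ψ.1 ^ (p ^ n) = 1) := by
  have : IsUltrametricDist L := IsUltrametricDist.of_normedAlgebra ℚ_[p]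
  have hi (a : ℚ_[p]) : ‖algebraMap ℚ_[p] L a‖ ≤ ‖a‖ := (norm_algebraMap' L a).le
  let E₀ : points γ n L → (weightAlg p n →A[ℚ_[p]] L) := fun ψ ↦
    TateDisk.evalAlgHom hi (((ψ.1 γ : Lˣ) : L) - 1) ψ.2.2
  have hE₀ (ψ) : E₀ ψ (t p n) = ((ψ.1 γ : Lˣ) : L) - 1 := TateDisk.evalAlgHom_coord hi ψ.2.2
  have hbij : Function.Bijective E₀ := by
    refine ⟨fun ψ ψ' h ↦ Subtype.ext ?_, fun e ↦ ?_⟩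
    · refine hγ.character_ext ψ.2.1 ψ'.2.1 (Units.ext ?_)
      have h1 := hE₀ ψ
      rw [h, hE₀ ψ'] at h1
      exact (sub_left_injective h1).symm
    · have he := norm_algHom_t_le e
      obtain ⟨ψ, hψ1, hψ2⟩ := hγ.exists_character (he.trans_lt (weightRadius_lt_one p n))
      have hψ3 : ((ψ γ : Lˣ) : L) - 1 = e (t p n) := by rw [hψ2, add_sub_cancel_left]
      exact ⟨⟨ψ, hψ1, by rwa [hψ3]⟩, TateDisk.algHom_ext ((hE₀ _).trans hψ3)⟩
  refine ⟨Equiv.ofBijective E₀ hbij, fun ψ ↦ ⟨hE₀ ψ, evalAlgHom_thetaFun hi ψ.2.2 _,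
    TateDisk.norm_evalAlgHom_le hi ψ.2.2, ?_⟩⟩
  have h1 : E₀ ψ ((1 + t p n) ^ (p ^ n) - 1) = ((ψ.1 γ : Lˣ) : L) ^ (p ^ n) - 1 := by
    rw [map_sub, map_pow, map_add, map_one, hE₀, add_sub_cancel]
  have h2 : (∀ f ∈ torsionIdeal p n, E₀ ψ f = 0) ↔ ((ψ.1 γ : Lˣ) : L) ^ (p ^ n) = 1 := by
    rw [← sub_eq_zero, ← h1]
    refine ⟨fun h ↦ h _ (Ideal.subset_span rfl), fun h f hf ↦ ?_⟩
    obtain ⟨a, rfl⟩ := Ideal.mem_span_singleton.1 hf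
    rw [map_mul, h, zero_mul]
  refine h2.trans ⟨fun h ↦ ?_, fun h ↦ ?_⟩
  · refine hγ.character_ext (fun u hu ↦ ?_) (fun u _ ↦ rfl) (Units.ext ?_)
    · rw [ContinuousMonoidHom.pow_apply, ψ.2.1 u hu, one_pow]
    · rw [ContinuousMonoidHom.pow_apply, Units.val_pow_eq_pow_val, h]
      rfl
  · have h3 := congrArg Units.val (DFunLike.congr_fun h γ)
    rw [ContinuousMonoidHom.pow_apply, Units.val_pow_eq_pow_val] at h3
    exact h3

end WeightSpace

end

open WeightSpace in
theorem mainTheorem1 (p : ℕ) [Fact p.Prime] (hp : p ≠ 2) (n : ℕ)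
    (γ : ℤ_[p]ˣ) (hγ : IsTopologicalGenerator p γ) :
    -- the pullback `φ : B → A` along `ϑ`
    ∃ φ : ballAlg p n →A[ℚ_[p]] weightAlg p n,
      (φ (s p n)).toPowerSeries = (logGen γ)⁻¹ • PowerSeries.log ℚ_[p] ∧
      (∀ φ' : ballAlg p n →A[ℚ_[p]] weightAlg p n, φ' (s p n) = φ (s p n) → φ' = φ) ∧
      -- on points over complete extensions `L` of `ℚ_p`, this is the map `ϑ` on characters
      (∀ (L : Type*) [NormedField L] [NormedAlgebra ℚ_[p] L] [CompleteSpace L],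
        (∀ ψ ∈ points γ n L, ‖theta γ ψ‖ ≤ ballRadius p n) ∧
        ([IsAlgClosed L] → ∀ x : L, ‖x‖ ≤ ballRadius p n → ∃ ψ ∈ points γ n L, theta γ ψ = x) ∧
        ∃ E : points γ n L ≃ (weightAlg p n →A[ℚ_[p]] L), ∀ ψ : points γ n L,
          E ψ (t p n) = ((ψ.1 γ : Lˣ) : L) - 1 ∧
          E ψ (φ (s p n)) = theta γ ψ.1 ∧
          ((∀ f ∈ torsionIdeal p n, E ψ f = 0) ↔ ψ.1 ^ (p ^ n) = 1)) ∧
      -- the pullback `act : A → A / ((1 + t) ^ (p ^ n) - 1) ⊗̂ A` along multiplication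
      ∃ act : weightAlg p n →A[ℚ_[p]] CompletedTensor ℚ_[p] (torsionAlg p n) (weightAlg p n),
        act (t p n) =
          CompletedTensor.inclRight ℚ_[p] (torsionAlg p n) (weightAlg p n) (t p n) +
          CompletedTensor.inclLeft ℚ_[p] (torsionAlg p n) (weightAlg p n)
            (Ideal.Quotient.mk (torsionIdeal p n) (t p n)) +
          CompletedTensor.inclLeft ℚ_[p] (torsionAlg p n) (weightAlg p n)
            (Ideal.Quotient.mk (torsionIdeal p n) (t p n)) *
          CompletedTensor.inclRight ℚ_[p] (torsionAlg p n) (weightAlg p n) (t p n) ∧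
        (∀ act' : weightAlg p n →A[ℚ_[p]]
            CompletedTensor ℚ_[p] (torsionAlg p n) (weightAlg p n),
          act' (t p n) = act (t p n) → act' = act) ∧
        IsAffinoidQuotient φ act := by
  have hg := hγ.norm_logGen hp
  have hg0 : logGen γ ≠ 0 := by
    intro h
    rw [h, norm_zero] at hg
    exact inv_ne_zero (by exact_mod_cast (Fact.out : p.Prime).ne_zero) hg.symm
  refine ⟨thetaPullback n hg, ?_, fun φ' h ↦ TateDisk.algHom_ext h, fun L _ _ _ ↦ ?_,
    actPullback p n, actPullback_t, fun act' h ↦ TateDisk.algHom_ext h,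
    isAffinoidQuotient_thetaPullback hg hg0⟩
  · rw [thetaPullback_s, toPowerSeries_thetaFun]
  · obtain ⟨E, hE⟩ := exists_pointsEquiv (L := L) hγ n
    refine ⟨fun ψ hψ ↦ ?_, fun x hx ↦ exists_theta_eq hγ hg hg0 hx, E, fun ψ ↦ ?_⟩
    · obtain ⟨-, h2, h3, -⟩ := hE ⟨ψ, hψ⟩
      rw [← h2]
      exact (h3 _).trans (norm_thetaFun_le hg)
    · obtain ⟨h1, h2, -, h4⟩ := hE ψ
      rw [thetaPullback_s]
      exact ⟨h1, h2, h4⟩
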